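/- Let $\Gamma$ be a finite group and let $Q$ be either $\mathbb{Q}$ or $\mathbb{F}_q(t)$ for a finite field $\mathbb{F}_q$. Let $K/Q$ be a Galois extension together with an isomorphism $\iota:\mathrm{Gal}(K/Q)\cong\Gamma$. Let $L/K$ be an extension such that $L/Q$ is Galois (possibly infinite), $L/K$ is unramified at every nonarchimedean place of $K$, and $\mathrm{Gal}(L/K)$ is a pro-$|\Gamma|'$ group, i.e. all its finite (continuous) quotients have order prime to $|\Gamma|$. When $Q=\mathbb{F}_q(t)$ (where every place, including those over $\infty$, is nonarchimedean), assume moreover that every place of $K$ above the infinite place of $\mathbb{F}_q(t)$ splits completely in $L/K$. Then $\mathrm{Gal}(L/K)$ is an admissible $\Gamma$-group. That is: there is a homomorphism $s:\Gamma\to\mathrm{Gal}(L/Q)$ that is a section of $\mathrm{Gal}(L/Q)\to\mathrm{Gal}(K/Q)\cong\Gamma$; and for every such section $s$, the action of $\Gamma$ on $G=\mathrm{Gal}(L/K)$ given by $\gamma(g)=s(\gamma)\,g\,s(\gamma)^{-1}$ makes $G$ a profinite group with continuous $\Gamma$-action, of order prime to $|\Gamma|$, which is topologically generated as a $\Gamma$-group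 by $\{g^{-1}\gamma(g)\mid g\in G,\ \gamma\in\Gamma\}$, i.e. the only closed $\Gamma$-stable subgroup of $G$ containing all these elements is $G$ itself. -/

import Mathlib

/-! ### Profinite groups with an action of a finite group -/

/-- A topological group is *pro-`n'`* (has order prime to `n` in the profinite sense) if every
quotient by an open normal subgroup has order prime to `n`. -/
def IsProPrimeTo (n : ℕ) (G : Type*) [Group G] [TopologicalSpace G] : Prop :=
  ∀ N : OpenNormalSubgroup G, (N.toSubgroup.index).Coprime n

/-- `G` with the action `act` of the finite (discrete) group `Γ` by group automorphisms is a
*`Γ`-group*: `G` is profinite and the action is continuous. -/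
structure IsProfiniteGammaGroup {Γ G : Type*} [Group Γ] [Group G] [TopologicalSpace G]
    (act : Γ →* MulAut G) : Prop where
  isTopologicalGroup : IsTopologicalGroup G
  compactSpace : CompactSpace G
  t2Space : T2Space G
  totallyDisconnectedSpace : TotallyDisconnectedSpace G
  continuous_act : ∀ γ : Γ, Continuous fun g : G => act γ g

/-- A `Γ`-group `G` is *admissible* if its order is prime to `|Γ|` and it is topologically
`Γ`-generated by the elements `g⁻¹ γ(g)`: the only closed `Γ`-stable subgroup containing all
of them is `G` itself. -/
structure IsAdmissibleGammaGroup {Γ G : Type*} [Group Γ] [Group G] [TopologicalSpace G]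
    (act : Γ →* MulAut G) : Prop extends IsProfiniteGammaGroup act where
  proPrimeTo : IsProPrimeTo (Nat.card Γ) G
  generated : ∀ H : Subgroup G, IsClosed (H : Set G) →
    (∀ (γ : Γ), ∀ h ∈ H, act γ h ∈ H) →
    (∀ (g : G) (γ : Γ), g⁻¹ * act γ g ∈ H) → H = ⊤

/-! ### The action of `Γ` on `Gal(L/K)` -/

section GaloisAction

variable {Q K L : Type*} [Field Q] [Field K] [Field L] [Algebra Q K] [Algebra Q L] [Algebra K L]
  [IsScalarTower Q K L] [Normal Q K]

/-- For `K/Q` normal, `τ ∈ Gal(L/Q)` and `σ ∈ Gal(L/K)`, the conjugate `τ σ τ⁻¹ ∈ Gal(L/K)`. -/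
noncomputable def conjGal (τ : Gal(L/Q)) (σ : Gal(L/K)) : Gal(L/K) :=
  AlgEquiv.ofRingEquiv (f := (τ.symm.toRingEquiv.trans σ.toRingEquiv).trans τ.toRingEquiv)
    (fun x => by
      change τ (σ (τ.symm (algebraMap K L x))) = algebraMap K L x
      rw [← AlgEquiv.restrictNormal_commutes τ.symm K x, AlgEquiv.commutes,
        AlgEquiv.restrictNormal_commutes, AlgEquiv.apply_symm_apply])

theorem conjGal_apply (τ : Gal(L/Q)) (σ : Gal(L/K)) (x : L) :
    conjGal τ σ x = τ (σ (τ⁻¹ x)) := rfl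

variable (Q K L) in
/-- The action of `Gal(L/Q)` on `Gal(L/K)` by conjugation, for `K/Q` normal. -/
noncomputable def conjGalHom : Gal(L/Q) →* MulAut Gal(L/K) where
  toFun τ :=
    { toFun := conjGal τ
      invFun := conjGal τ⁻¹
      left_inv := fun σ => by ext x; simp [conjGal_apply]
      right_inv := fun σ => by ext x; simp [conjGal_apply]
      map_mul' := fun σ σ' => by ext x; simp [conjGal_apply] }
  map_one' := by ext σ x; rfl
  map_mul' := fun τ τ' => by ext σ x; rfl

/-- `s : Γ → Gal(L/Q)` is a section (a homomorphism splitting `Gal(L/Q) → Gal(K/Q) ≅ Γ`). -/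
def IsGaloisSection {Γ : Type*} [Group Γ] (ι : Gal(K/Q) ≃* Γ) (s : Γ →* Gal(L/Q)) : Prop :=
  ∀ γ : Γ, ι (AlgEquiv.restrictNormalHom K (s γ)) = γ

variable (L) in
/-- `Gal(L/K)` is an admissible `Γ`-group: there are sections `s : Γ → Gal(L/Q)`, and for each of
them the action of `Γ` on `Gal(L/K)` (with its Krull topology) via `s` and conjugation is
admissible. -/
def GaloisGroupIsAdmissible {Γ : Type*} [Group Γ] (ι : Gal(K/Q) ≃* Γ) : Prop :=
  (∃ s : Γ →* Gal(L/Q), IsGaloisSection ι s) ∧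
  ∀ s : Γ →* Gal(L/Q), IsGaloisSection ι s →
    IsAdmissibleGammaGroup (G := Gal(L/K)) ((conjGalHom Q K L).comp s)

end GaloisAction

/-! ### Ramification

A (nonarchimedean) place of a number field or of a global function field is the same thing as a
valuation subring different from the whole field. The place below a place `B` of `F` is
`B.comap (algebraMap K F)`. -/

section Ramification

variable (K : Type*) {F : Type*} [Field K] [Field F] [Algebra K F]

/-- The inclusion of the valuation ring of the place of `K` below `B` into `B`. -/
def placeBelowHom (B : ValuationSubring F) : B.comap (algebraMap K F) →+* B :=
  (algebraMap K F).restrict (B.comap (algebraMap K F)) B (fun _ h => h)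

instance isLocalHom_placeBelowHom (B : ValuationSubring F) : IsLocalHom (placeBelowHom K B) where
  map_nonunit a ha := by
    obtain ⟨u, hu⟩ := ha
    have hval : ((u : B) : F) = algebraMap K F a := congrArg Subtype.val hu
    have hinv : ((u : B) : F) * ((u⁻¹ : Bˣ) : B) = 1 := by
      exact_mod_cast congrArg Subtype.val (Units.mul_inv u)
    rw [hval] at hinv
    have ha0 : (a : K) ≠ 0 := by
      intro h
      rw [h, map_zero, zero_mul] at hinv
      exact zero_ne_one hinv
    have hmem : (a : K)⁻¹ ∈ B.comap (algebraMap K F) := by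
      change algebraMap K F (a : K)⁻¹ ∈ B
      rw [map_inv₀, ← eq_inv_of_mul_eq_one_right hinv]
      exact Subtype.property _
    exact IsUnit.of_mul_eq_one ⟨(a : K)⁻¹, hmem⟩ (Subtype.ext (mul_inv_cancel₀ ha0))

/-- The extension of residue fields at the place `B` of `F`. -/
noncomputable def placeResidueHom (B : ValuationSubring F) :
    IsLocalRing.ResidueField (B.comap (algebraMap K F)) →+* IsLocalRing.ResidueField B :=
  IsLocalRing.ResidueField.map (placeBelowHom K B)

/-- The place `B` of `F` is unramified over `K`: the maximal ideal of the place below generates the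
maximal ideal of `B` (ramification index one), and the residue field extension is separable. -/
structure IsUnramifiedPlace (B : ValuationSubring F) : Prop where
  map_maximalIdeal :
    (IsLocalRing.maximalIdeal (B.comap (algebraMap K F))).map (placeBelowHom K B) =
      IsLocalRing.maximalIdeal B
  isSeparable :
    letI := (placeResidueHom K B).toAlgebra
    Algebra.IsSeparable (IsLocalRing.ResidueField (B.comap (algebraMap K F)))
      (IsLocalRing.ResidueField B)

/-- An algebraic extension `L/K` is unramified (at all nonarchimedean places) if all places of all
finite subextensions `F/K` are unramified over `K`. -/
def IsUnramifiedExtension (K L : Type*) [Field K] [Field L] [Algebra K L] : Prop :=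
  ∀ F : IntermediateField K L, FiniteDimensional K F →
    ∀ B : ValuationSubring F, B ≠ ⊤ → IsUnramifiedPlace K B

/-- A place `A` of `K` splits completely in the algebraic extension `L/K` if, in every finite
subextension `F/K`, every place above `A` is unramified with residue field extension of
degree one. -/
def SplitsCompletelyIn {K : Type*} [Field K] (A : ValuationSubring K) (L : Type*) [Field L]
    [Algebra K L] : Prop :=
  ∀ F : IntermediateField K L, FiniteDimensional K F →
    ∀ B : ValuationSubring F, B.comap (algebraMap K F) = A →
      IsUnramifiedPlace K B ∧ Function.Surjective (placeResidueHom K B)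

end Ramification

open Classical in
/-- The infinite place of `k(t)`: the valuation ring `{f | deg f ≤ 0}`. -/
noncomputable def ratFuncInftyPlace (k : Type*) [Field k] : ValuationSubring (RatFunc k) :=
  (RatFunc.inftyValuation k).valuationSubring

/-! ### Schur–Zassenhaus for profinite groups -/

open scoped Pointwise

/-! Sections exist by Schur–Zassenhaus, passed to the limit by compactness
(`exists_section_of_coprime`).

For generation, let `H` be closed, `Γ`-stable and contain all `g⁻¹ γ(g)`. Then `H · s(Γ)` is a
closed subgroup of `Gal(L/Q)` containing every conjugate of `s(Γ)`, hence the closed normal subgroup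
these generate. It is therefore enough that no nontrivial finite Galois `M/Q` inside `L` is fixed by
`s(Γ)` (`eq_top_of_forall_fixed_eq_bot`).

For such an `M`, `Gal(M/Q)` is a quotient of `Gal(L/K)`, so its order is prime to `|Γ|`. Choose a
finite `F/K` containing `M`. As `F/K` is unramified, each ramification index of `M/Q` divides one of
`K/Q`, hence divides `|Γ|`; it also divides `|Gal(M/Q)|`, so it is 1. The same argument with inertia
degrees shows that the infinite place of `𝔽_q(t)` has inertia degree 1 in `M`
(`exists_heightOneSpectrum_above`).

Over `ℚ`, Minkowski's theorem gives `M = ℚ`. Over `k(t)`, `finrank_eq_one_of_isUnramifiedAt`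
replaces Riemann–Hurwitz by geometry of numbers. The integral closures of `k[t]` and of the local
ring at infinity have unit discriminants, so together they behave like a vector bundle of degree 0
on the projective line without nonzero sections vanishing at infinity. Such a bundle is trivial:
lattice reduction yields a basis of `M` made of functions regular everywhere. A place of degree one
over infinity forces these to be constants in `k`, so `M` has dimension 1. -/

theorem exists_lift_mod_of_coprime {E Γ : Type*} [Group E] [Group Γ] (π : E →* Γ)
    (hπ : Function.Surjective π) (W : Subgroup E) [W.Normal] [W.FiniteIndex] (hW : W ≤ π.ker)
    (hcop : (W.relIndex π.ker).Coprime (Nat.card Γ)) :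
    ∃ s : Γ → E, (∀ γ, π (s γ) = γ) ∧ ∀ γ δ, s γ * s δ * (s (γ * δ))⁻¹ ∈ W := by
  let N : Subgroup (E ⧸ W) := π.ker.map (QuotientGroup.mk' W)
  let p : E ⧸ W →* Γ := QuotientGroup.lift W π hW
  have hp : Function.Surjective p := fun γ => by
    obtain ⟨e, rfl⟩ := hπ γ
    exact ⟨QuotientGroup.mk e, rfl⟩
  have hpN : p.ker = N := by
    ext x
    obtain ⟨e, rfl⟩ := QuotientGroup.mk_surjective x
    constructor
    · intro h
      exact ⟨e, h, rfl⟩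
    · rintro ⟨e', he', h⟩
      rw [← h]
      exact he'
  have hidx : p.ker.index = Nat.card Γ := by
    rw [Subgroup.index_ker, MonoidHom.range_eq_top.2 hp, Subgroup.card_top]
  have hcard : Nat.card p.ker = W.relIndex π.ker := by
    have h := Subgroup.relIndex_ker (QuotientGroup.mk' W) (K := π.ker)
    rw [QuotientGroup.ker_mk'] at h
    rw [h, hpN]
  -- Schur–Zassenhaus in the finite group `E ⧸ W`: the complement maps isomorphically to `Γ`, and
  -- arbitrary lifts of its elements to `E` are multiplicative modulo `W`.
  obtain ⟨C, hC⟩ := Subgroup.exists_right_complement'_of_coprime (N := p.ker)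
    (by rw [hidx, hcard]; exact hcop)
  let f : C →* Γ := p.comp C.subtype
  have hf : Function.Bijective f := by
    constructor
    · rw [injective_iff_map_eq_one]
      rintro ⟨c, hc⟩ h
      have : c ∈ p.ker ⊓ C := ⟨h, hc⟩
      rw [hC.disjoint.eq_bot] at this
      exact Subtype.ext this
    · intro γ
      obtain ⟨x, rfl⟩ := hp γ
      obtain ⟨⟨n, c⟩, h⟩ := hC.2 x
      refine ⟨c, ?_⟩
      have hn : p n = 1 := n.2
      rw [← h, map_mul, hn, one_mul]
      rfl
  let g : Γ ≃* C := (MulEquiv.ofBijective f hf).symm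
  have hg : ∀ γ, p (g γ : E ⧸ W) = γ := fun γ => (MulEquiv.ofBijective f hf).apply_symm_apply γ
  choose s hs using fun γ => QuotientGroup.mk_surjective (g γ : E ⧸ W)
  refine ⟨s, fun γ => ?_, fun γ δ => ?_⟩
  · have h := hg γ
    rw [← hs γ] at h
    exact h
  · rw [← QuotientGroup.eq_one_iff, QuotientGroup.mk_mul, QuotientGroup.mk_mul,
      QuotientGroup.mk_inv, hs, hs, hs, map_mul, Subgroup.coe_mul, mul_inv_cancel]

/-- Schur–Zassenhaus for profinite groups: a surjection onto a finite group whose kernel is open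
and of order prime to the order of the image splits. -/
theorem exists_section_of_coprime {E Γ : Type*} [Group E] [TopologicalSpace E]
    [IsTopologicalGroup E] [CompactSpace E] [TotallyDisconnectedSpace E] [T2Space E]
    [Group Γ] [Finite Γ] (π : E →* Γ) (hπ : Function.Surjective π)
    (hker : IsOpen (π.ker : Set E))
    (hcop : ∀ W : OpenNormalSubgroup E, (W.toSubgroup.relIndex π.ker).Coprime (Nat.card Γ)) :
    ∃ s : Γ →* E, ∀ γ, π (s γ) = γ := by
  let ι := {W : OpenNormalSubgroup E // W.toSubgroup ≤ π.ker}
  let kerN : OpenNormalSubgroup E :=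
    { toSubgroup := π.ker, isOpen' := hker, isNormal' := inferInstance }
  have hfib : ∀ γ, IsClosed {e | π e = γ} := fun γ => by
    obtain ⟨e, rfl⟩ := hπ γ
    have : {x | π x = π e} = (fun x => e⁻¹ * x) ⁻¹' (π.ker : Set E) := by
      ext x
      simp [MonoidHom.mem_ker, eq_inv_mul_iff_mul_eq, eq_comm]
    rw [this]
    exact (Subgroup.isClosed_of_isOpen _ hker).preimage (by fun_prop)
  -- These sets are closed in a compact space, nonempty by the finite case, and directed; a common
  -- point is multiplicative modulo every small open normal subgroup, hence a homomorphism.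
  let C : ι → Set (Γ → E) := fun W =>
    {s | (∀ γ, π (s γ) = γ) ∧ ∀ γ δ, s γ * s δ * (s (γ * δ))⁻¹ ∈ W.1.toSubgroup}
  have hCcl : ∀ W, IsClosed (C W) := fun W => by
    have h1 : IsClosed {s : Γ → E | ∀ γ, π (s γ) = γ} := by
      rw [Set.ofPred_forall]
      exact isClosed_iInter fun γ =>
        (show IsClosed ((fun p : Γ → E => p γ) ⁻¹' {e | π e = γ}) from
          (hfib γ).preimage (continuous_apply γ))
    have h2 : IsClosed {s : Γ → E | ∀ γ δ, s γ * s δ * (s (γ * δ))⁻¹ ∈ W.1.toSubgroup} := by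
      simp only [Set.ofPred_forall]
      refine isClosed_iInter fun γ => isClosed_iInter fun δ => ?_
      exact (Subgroup.isClosed_of_isOpen _ W.1.isOpen').preimage
        (f := fun s : Γ → E => s γ * s δ * (s (γ * δ))⁻¹) (by fun_prop)
    exact h1.inter h2
  have : Nonempty ι := ⟨⟨kerN, le_rfl⟩⟩
  have hne : (⋂ W, C W).Nonempty := by
    refine IsCompact.nonempty_iInter_of_directed_nonempty_isCompact_isClosed C ?_ ?_ ?_ hCcl
    · intro W₁ W₂
      refine ⟨⟨W₁.1 ⊓ W₂.1, fun x hx => W₁.2 hx.1⟩, ?_, ?_⟩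
      · exact fun s hs => ⟨hs.1, fun γ δ => (hs.2 γ δ).1⟩
      · exact fun s hs => ⟨hs.1, fun γ δ => (hs.2 γ δ).2⟩
    · intro W
      have : W.1.toSubgroup.Normal := W.1.isNormal'
      have : W.1.toSubgroup.FiniteIndex :=
        have := Subgroup.quotient_finite_of_isOpen _ W.1.isOpen'
        Subgroup.finiteIndex_of_finite_quotient
      obtain ⟨s, hs⟩ := exists_lift_mod_of_coprime π hπ W.1.toSubgroup W.2 (hcop W.1)
      exact ⟨s, hs⟩
    · exact fun W => (hCcl W).isCompact
  obtain ⟨s, hs⟩ := hne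
  rw [Set.mem_iInter] at hs
  have hmul : ∀ γ δ, s (γ * δ) = s γ * s δ := fun γ δ => by
    by_contra hne
    have hne' : s γ * s δ * (s (γ * δ))⁻¹ ≠ 1 := fun h => hne (mul_inv_eq_one.1 h).symm
    obtain ⟨W, hW⟩ := ProfiniteGrp.exist_openNormalSubgroup_sub_open_nhds_of_one
      (G := E) (U := {s γ * s δ * (s (γ * δ))⁻¹}ᶜ) isOpen_compl_singleton
      (fun h => hne' (Set.mem_singleton_iff.1 h).symm)
    have := (hs ⟨W ⊓ kerN, fun x hx => hx.2⟩).2 γ δ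
    exact hW this.1 rfl
  exact ⟨MonoidHom.mk' s hmul, (hs ⟨kerN, le_rfl⟩).1⟩

/-! ### Reduction to finite Galois extensions fixed by a section -/

section Galois

variable {Q K L : Type*} [Field Q] [Field K] [Field L] [Algebra Q K] [Algebra Q L] [Algebra K L]
  [IsScalarTower Q K L]

/-- A finite `E/Q` is generated by a finite set, and adjoining that set to `K` gives a finite
extension of `K` whose fixing subgroup also fixes `E`. -/
theorem continuous_restrictScalarsHom [Algebra.IsAlgebraic Q L] :
    Continuous (AlgEquiv.restrictScalarsHom Q : Gal(L/K) →* Gal(L/Q)) := by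
  refine continuous_of_continuousAt_one _ (continuousAt_def.mpr fun N hN => ?_)
  rw [map_one, krullTopology_mem_nhds_one_iff] at hN
  obtain ⟨E, hE, hEN⟩ := hN
  rw [krullTopology_mem_nhds_one_iff]
  have hfg : (E : IntermediateField Q L).FG := IntermediateField.essFiniteType_iff.1 inferInstance
  obtain ⟨S, hS⟩ := hfg
  refine ⟨IntermediateField.adjoin K (S : Set L), ?_, fun σ hσ => hEN ?_⟩
  · refine IntermediateField.finiteDimensional_adjoin fun x _ => ?_
    exact (Algebra.IsIntegral.isIntegral (R := Q) x).tower_top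
  · rintro ⟨x, hx⟩
    have hle : E ≤ (IntermediateField.adjoin K (S : Set L)).restrictScalars Q := by
      rw [← hS, IntermediateField.adjoin_le_iff]
      exact IntermediateField.subset_adjoin K _
    exact hσ ⟨x, hle hx⟩

variable [Normal Q K]

theorem range_restrictScalarsHom :
    (AlgEquiv.restrictScalarsHom Q : Gal(L/K) →* Gal(L/Q)).range =
      (AlgEquiv.restrictNormalHom (F := Q) (K₁ := L) K).ker := by
  ext τ
  constructor
  · rintro ⟨σ, rfl⟩
    ext x
    apply (algebraMap K L).injective
    simp [AlgEquiv.restrictNormalHom, AlgEquiv.restrictNormal_commutes]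
  · intro h
    refine ⟨AlgEquiv.ofRingEquiv (f := τ.toRingEquiv) fun x => ?_, by ext; rfl⟩
    have := AlgEquiv.restrictNormal_commutes τ K x
    rw [show τ.restrictNormal K = 1 from h] at this
    exact this.symm

theorem exists_eq_restrictScalars_mul {Γ : Type*} [Group Γ] {ι : Gal(K/Q) ≃* Γ}
    {s : Γ →* Gal(L/Q)} (hs : IsGaloisSection ι s) (e : Gal(L/Q)) :
    ∃ (g : Gal(L/K)) (γ : Γ), e = AlgEquiv.restrictScalarsHom Q g * s γ := by
  let γ := ι (AlgEquiv.restrictNormalHom K e)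
  have : e * (s γ)⁻¹ ∈ (AlgEquiv.restrictScalarsHom Q : Gal(L/K) →* Gal(L/Q)).range := by
    rw [range_restrictScalarsHom, MonoidHom.mem_ker, map_mul, map_inv, mul_inv_eq_one]
    exact ι.injective (hs γ).symm
  obtain ⟨g, hg⟩ := this
  exact ⟨g, γ, by rw [hg, inv_mul_cancel_right]⟩

variable [IsGalois Q L] {Γ : Type*} [Group Γ] [Finite Γ] (ι : Gal(K/Q) ≃* Γ)

theorem exists_isGaloisSection [FiniteDimensional Q K]
    (hcop : IsProPrimeTo (Nat.card Γ) Gal(L/K)) :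
    ∃ s : Γ →* Gal(L/Q), IsGaloisSection ι s := by
  let j : Gal(L/K) →* Gal(L/Q) := AlgEquiv.restrictScalarsHom Q
  let π : Gal(L/Q) →* Γ := ι.toMonoidHom.comp (AlgEquiv.restrictNormalHom K)
  have hker : π.ker = j.range := by
    rw [range_restrictScalarsHom]
    ext
    simp [π, MonoidHom.mem_ker]
  refine exists_section_of_coprime π
    (ι.surjective.comp (AlgEquiv.restrictNormalHom_surjective L)) ?_ fun W => ?_
  · rw [hker]
    -- The kernel is the fixing subgroup of the image of `K` in `L`, which is finite over `Q`; hence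
    -- it is open.
    let K' : IntermediateField Q L := (IsScalarTower.toAlgHom Q K L).fieldRange
    have : FiniteDimensional Q K' :=
      (IsScalarTower.toAlgHom Q K L).toLinearMap.finiteDimensional_range
    convert! IntermediateField.fixingSubgroup_isOpen K'
    rw [range_restrictScalarsHom]
    ext τ
    simp only [MonoidHom.mem_ker, IntermediateField.mem_fixingSubgroup_iff]
    constructor
    · rintro h _ ⟨x, rfl⟩
      have := AlgEquiv.restrictNormal_commutes τ K x
      rw [show τ.restrictNormal K = 1 from h] at this
      exact this.symm
    · intro h
      ext x
      apply (algebraMap K L).injective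
      exact (AlgEquiv.restrictNormal_commutes τ K x).trans (h _ ⟨x, rfl⟩)
  · rw [hker, ← Subgroup.index_comap]
    have := W.isNormal'
    exact hcop
      { toSubgroup := W.toSubgroup.comap j
        isOpen' := W.isOpen'.preimage continuous_restrictScalarsHom
        isNormal' := inferInstance }

/-- A closed `Γ`-stable subgroup containing all `g⁻¹ γ(g)` is everything as soon as `Q` is the only
finite Galois subextension on which a section acts trivially. -/
theorem eq_top_of_forall_fixed_eq_bot (s : Γ →* Gal(L/Q)) (hs : IsGaloisSection ι s)
    (hM : ∀ M : IntermediateField Q L, FiniteDimensional Q M → IsGalois Q M →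
      (∀ γ, ∀ x ∈ M, s γ x = x) → M = ⊥)
    (H : Subgroup Gal(L/K)) (hH : IsClosed (H : Set Gal(L/K)))
    (hstab : ∀ γ, ∀ h ∈ H, conjGal (s γ) h ∈ H)
    (hgen : ∀ g γ, g⁻¹ * conjGal (s γ) g ∈ H) : H = ⊤ := by
  have : IsGalois K L := IsGalois.tower_top_of_isGalois Q K L
  let j : Gal(L/K) →* Gal(L/Q) := AlgEquiv.restrictScalarsHom Q
  have hj : Function.Injective j := AlgEquiv.restrictScalars_injective Q
  have hconj : ∀ γ g, j (conjGal (s γ) g) = s γ * j g * (s γ)⁻¹ := fun γ g => rfl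
  have hjr : ∀ g, AlgEquiv.restrictNormalHom (F := Q) (K₁ := L) K (j g) = 1 := fun g =>
    (range_restrictScalarsHom (Q := Q) (K := K) (L := L)).le ⟨g, rfl⟩
  have hdec : ∀ e : Gal(L/Q), ∃ g γ, e = j g * s γ := exists_eq_restrictScalars_mul hs
  -- The product `H · s(Γ)`, a subgroup because `H` is stable under conjugation by `s(Γ)`.
  let D : Subgroup Gal(L/Q) :=
    { carrier := {e | ∃ h ∈ H, ∃ γ, e = j h * s γ}
      one_mem' := ⟨1, H.one_mem, 1, by simp⟩
      mul_mem' := by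
        rintro _ _ ⟨h, hh, γ, rfl⟩ ⟨h', hh', γ', rfl⟩
        refine ⟨h * conjGal (s γ) h', H.mul_mem hh (hstab γ _ hh'), γ * γ', ?_⟩
        rw [map_mul, hconj, map_mul]
        group
      inv_mem' := by
        rintro _ ⟨h, hh, γ, rfl⟩
        refine ⟨conjGal (s γ⁻¹) h⁻¹, hstab _ _ (H.inv_mem hh), γ⁻¹, ?_⟩
        rw [hconj, map_inv, map_inv]
        group }
  have hDcl : IsClosed (D : Set Gal(L/Q)) := by
    have : (D : Set Gal(L/Q)) = ⋃ γ, (fun h => j h * s γ) '' (H : Set Gal(L/K)) := by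
      ext e
      simp only [Set.mem_iUnion]
      constructor
      · rintro ⟨h, hh, γ, rfl⟩
        exact ⟨γ, h, hh, rfl⟩
      · rintro ⟨γ, h, hh, rfl⟩
        exact ⟨h, hh, γ, rfl⟩
    rw [this]
    refine isClosed_iUnion_of_finite fun γ => (hH.isCompact.image ?_).isClosed
    exact continuous_restrictScalarsHom.mul continuous_const
  -- The closure is taken so that the infinite Galois correspondence applies to `W`.
  let W : Subgroup Gal(L/Q) := (Subgroup.normalClosure (s.range : Set Gal(L/Q))).topologicalClosure
  have hWn : W.Normal := Subgroup.is_normal_topologicalClosure _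
  have hWD : W ≤ D := by
    refine Subgroup.topologicalClosure_minimal _ ?_ hDcl
    rw [Subgroup.normalClosure, Subgroup.closure_le]
    intro x hx
    obtain ⟨_, ⟨γ, rfl⟩, hx⟩ := Group.mem_conjugatesOfSet_iff.1 hx
    obtain ⟨e, rfl⟩ := isConj_iff.1 hx
    obtain ⟨g, δ, rfl⟩ := hdec e
    -- With `e = g s(δ)` and `ε = δγδ⁻¹`, one has `e s(γ) e⁻¹ = g s(ε) g⁻¹ = (g · ε(g⁻¹)) s(ε)`,
    -- whose first factor is a generator of the required form for `g⁻¹`.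
    refine ⟨_, hgen g⁻¹ (δ * γ * δ⁻¹), δ * γ * δ⁻¹, ?_⟩
    rw [map_mul, hconj, map_inv, map_inv]
    simp only [map_mul, map_inv]
    group
  have hsW : ∀ γ, s γ ∈ W := fun γ =>
    Subgroup.le_topologicalClosure _ (Subgroup.subset_normalClosure ⟨γ, rfl⟩)
  let X : IntermediateField Q L := IntermediateField.fixedField W
  have hXW : X.fixingSubgroup = W :=
    InfiniteGalois.fixingSubgroup_fixedField ⟨W, Subgroup.isClosed_topologicalClosure _⟩
  have hXgal : IsGalois Q X := by
    rw [← InfiniteGalois.normal_iff_isGalois, hXW]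
    exact hWn
  have hXbot : X = ⊥ := by
    rw [eq_bot_iff]
    intro x hx
    -- The hypothesis concerns finite extensions only, while `X` may be infinite: it is exhausted by
    -- normal closures of simple extensions.
    let M := IntermediateField.normalClosure Q (IntermediateField.adjoin Q {x}) L
    have hxi : IsIntegral Q x := Algebra.IsIntegral.isIntegral x
    have : FiniteDimensional Q (IntermediateField.adjoin Q {x}) :=
      IntermediateField.adjoin.finiteDimensional hxi
    have hle : IntermediateField.adjoin Q {x} ≤ X :=
      IntermediateField.adjoin_simple_le_iff.2 hx
    have hMX : M ≤ X := IntermediateField.normalClosure_le_iff_of_normal.2 hle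
    have hMbot : M = ⊥ := by
      refine hM M inferInstance ⟨⟩ fun γ y hy => ?_
      have := hMX hy
      rw [IntermediateField.mem_fixedField_iff] at this
      exact this _ (hsW γ)
    rw [← hMbot]
    exact IntermediateField.le_normalClosure _ (IntermediateField.mem_adjoin_simple_self Q x)
  have hDtop : ∀ e, e ∈ D := fun e => hWD (by rw [← hXW, hXbot]; simp)
  rw [eq_top_iff]
  rintro g -
  obtain ⟨h, hh, γ, hg⟩ := hDtop (j g)
  have hγ : γ = 1 := by
    have h1 := congrArg (AlgEquiv.restrictNormalHom (F := Q) (K₁ := L) K) hg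
    rw [map_mul, hjr, hjr, one_mul] at h1
    have h2 := hs γ
    rw [← h1, map_one] at h2
    exact h2.symm
  rw [hγ, map_one, mul_one] at hg
  rwa [hj hg]

end Galois

/-! ### Lattice reduction for the degree valuation -/

section RatFuncInfty

open WithZero
open scoped Polynomial

namespace RatFunc

variable {k : Type*} [Field k] [DecidableEq (RatFunc k)]

theorem inftyValuation_algebraMap_of_ne_zero {p : k[X]} (hp : p ≠ 0) :
    inftyValuation k (algebraMap k[X] (RatFunc k) p) = exp (p.natDegree : ℤ) := by
  rw [inftyValuation_apply, inftyValuation.polynomial k hp]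

theorem one_le_inftyValuation_algebraMap {p : k[X]} (hp : p ≠ 0) :
    1 ≤ inftyValuation k (algebraMap k[X] (RatFunc k) p) := by
  rw [inftyValuation_algebraMap_of_ne_zero hp, ← exp_zero, exp_le_exp]
  positivity

theorem inftyValuation_C_lt_one {c : k} (h : inftyValuation k (C c) < 1) : c = 0 := by
  by_contra hc
  rw [inftyValuation.C k hc] at h
  exact lt_irrefl _ h

theorem inftyValuation_C_le_one (c : k) : inftyValuation k (C c) ≤ 1 := by
  rcases eq_or_ne c 0 with rfl | hc
  · simp
  · exact (inftyValuation.C k hc).le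

/-- The residue field of the infinite place of `k(t)` is `k`. -/
theorem exists_inftyValuation_sub_C_lt_one {f : RatFunc k} (hf : inftyValuation k f ≤ 1) :
    ∃ c : k, inftyValuation k (f - C c) < 1 := by
  rcases hf.lt_or_eq with h | h
  · exact ⟨0, by simpa using h⟩
  have hd0 : f.denom ≠ 0 := f.denom_ne_zero
  have hd0' : algebraMap k[X] (RatFunc k) f.denom ≠ 0 := by simpa using hd0
  have hf0 : f ≠ 0 := by
    rintro rfl
    simp at h
  have hn0 : f.num ≠ 0 := num_ne_zero hf0
  have hfd : f * algebraMap k[X] (RatFunc k) f.denom = algebraMap k[X] (RatFunc k) f.num := by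
    nth_rw 1 [← num_div_denom f]
    exact div_mul_cancel₀ _ hd0'
  have hdeg : f.num.natDegree = f.denom.natDegree := by
    have := congrArg (inftyValuation k) hfd
    rw [map_mul, h, one_mul, inftyValuation_algebraMap_of_ne_zero hd0,
      inftyValuation_algebraMap_of_ne_zero hn0, exp_inj] at this
    exact_mod_cast this.symm
  -- The denominator is monic of the same degree as the numerator, so this constant cancels the
  -- leading term.
  refine ⟨f.num.leadingCoeff, ?_⟩
  let p := f.num - Polynomial.C f.num.leadingCoeff * f.denom
  have hp : (f - C f.num.leadingCoeff) * algebraMap k[X] (RatFunc k) f.denom =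
      algebraMap k[X] (RatFunc k) p := by
    rw [sub_mul, hfd, map_sub, map_mul, algebraMap_C]
  have hlt : p.degree < f.num.degree := by
    refine Polynomial.degree_sub_lt_left ?_ hn0 ?_
    · rw [Polynomial.degree_C_mul (Polynomial.leadingCoeff_ne_zero.2 hn0),
        Polynomial.degree_eq_natDegree hn0, Polynomial.degree_eq_natDegree hd0, hdeg]
    · rw [Polynomial.leadingCoeff_mul, Polynomial.leadingCoeff_C, (monic_denom f).leadingCoeff,
        mul_one]
  have hvd : inftyValuation k (algebraMap k[X] (RatFunc k) f.denom) ≠ 0 := by simpa using hd0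
  have hvp : inftyValuation k (algebraMap k[X] (RatFunc k) p) <
      inftyValuation k (algebraMap k[X] (RatFunc k) f.denom) := by
    rcases eq_or_ne p 0 with h0 | h0
    · rw [h0, map_zero, map_zero]
      exact zero_lt_iff.2 hvd
    · rw [inftyValuation_algebraMap_of_ne_zero h0, inftyValuation_algebraMap_of_ne_zero hd0,
        exp_lt_exp, ← hdeg]
      exact_mod_cast Polynomial.natDegree_lt_natDegree h0 hlt
  rw [← hp, map_mul] at hvp
  by_contra hge
  exact absurd hvp (not_lt.2 (le_mul_of_one_le_left' (not_lt.1 hge)))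

end RatFunc

/-- The matrices agree modulo the ideal `v < 1` of the valuation ring, and the determinant commutes
with reduction. -/
theorem Valuation.det_sub_det_lt_one {R Γ₀ ι : Type*} [CommRing R]
    [LinearOrderedCommGroupWithZero Γ₀] [Fintype ι] [DecidableEq ι] (v : Valuation R Γ₀)
    {A B : Matrix ι ι R} (hB : ∀ i j, v (B i j) ≤ 1) (hAB : ∀ i j, v (A i j - B i j) < 1) :
    v (A.det - B.det) < 1 := by
  have hA : ∀ i j, v (A i j) ≤ 1 := fun i j => by
    rw [← sub_add_cancel (A i j) (B i j)]
    exact v.map_add_le (hAB i j).le (hB i j)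
  let I : Ideal v.integer :=
    { carrier := {x | v x < 1}
      add_mem' := fun {x y} hx hy => v.map_add_lt hx hy
      zero_mem' := by
        change v ((0 : v.integer) : R) < 1
        simp
      smul_mem' := fun c x hx => by
        change v ((c : R) * x) < 1
        rw [map_mul]
        exact mul_lt_one_of_nonneg_of_lt_one_right c.2 zero_le hx }
  let A' : Matrix ι ι v.integer := fun i j => ⟨A i j, hA i j⟩
  let B' : Matrix ι ι v.integer := fun i j => ⟨B i j, hB i j⟩
  have h : Ideal.Quotient.mk I A'.det = Ideal.Quotient.mk I B'.det := by
    rw [RingHom.map_det, RingHom.map_det]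
    congr 1
    ext i j
    exact Ideal.Quotient.eq.2 (hAB i j)
  have h' : v ((A'.det - B'.det : v.integer) : R) < 1 := Ideal.Quotient.eq.1 h
  have hcoe : ∀ C : Matrix ι ι v.integer, ((C.det : v.integer) : R) =
      (C.map v.integer.subtype).det := fun C => RingHom.map_det v.integer.subtype C
  rw [show ((A'.det - B'.det : v.integer) : R) = A'.det - B'.det from rfl, hcoe, hcoe] at h'
  exact h'

open RatFunc in
/-- Lattice reduction over `k[t]` with respect to the degree valuation: if a `k[t]`-lattice `A`
contains a family of determinant of degree zero and no nonzero vector with all coordinates of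
negative degree, then it contains such a family with all coordinates of degree at most zero. -/
theorem exists_reduced_family {k M ι : Type*} [Field k] [DecidableEq (RatFunc k)] [AddCommGroup M]
    [Module (RatFunc k) M] [Module k[X] M] [IsScalarTower k[X] (RatFunc k) M]
    [Fintype ι] [DecidableEq ι] (b : Module.Basis ι (RatFunc k) M) (A : Submodule k[X] M)
    (hA : ∀ x ∈ A, (∀ i, inftyValuation k (b.repr x i) < 1) → x = 0) (N : ℕ) :
    ∀ (a : ι → M) (d : ι → ℕ), ∑ i, d i = N → (∀ i, a i ∈ A) →
      (∀ i j, inftyValuation k (b.repr (a i) j) ≤ exp (d i : ℤ)) →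
      inftyValuation k (b.det a) = 1 →
      ∃ a' : ι → M, (∀ i, a' i ∈ A) ∧ (∀ i j, inftyValuation k (b.repr (a' i) j) ≤ 1) ∧
        inftyValuation k (b.det a') = 1 := by
  classical
  set v := inftyValuation k with hv
  induction N with
  | zero =>
    intro a d hd haA had hdet
    refine ⟨a, haA, fun i j => ?_, hdet⟩
    have : d i = 0 := (Finset.sum_eq_zero_iff.1 hd) i (Finset.mem_univ i)
    simpa [this] using had i j
  | succ N ih =>
    intro a d hd haA had hdet
    have hX : (RatFunc.X : RatFunc k) ≠ 0 := RatFunc.X_ne_zero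
    have hvX : ∀ m : ℤ, v (RatFunc.X ^ m) = exp m := inftyValuation.X_zpow k
    -- Scaling column `i` by `X ^ (-d i)` makes the entries integral at infinity and the determinant
    -- of degree `-(N + 1) < 0`; the residue matrix over `k` is then singular, and a kernel vector
    -- lets the leading terms cancel.
    let P : Matrix ι ι (RatFunc k) := fun l i => RatFunc.X ^ (-(d i : ℤ)) * b.toMatrix a l i
    have hP : ∀ l i, v (P l i) ≤ 1 := fun l i => by
      rw [map_mul, hvX, Module.Basis.toMatrix_apply]
      calc exp (-(d i : ℤ)) * v (b.repr (a i) l)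
          ≤ exp (-(d i : ℤ)) * exp (d i : ℤ) := mul_le_mul_right (had i l) _
        _ = 1 := by rw [← exp_add, neg_add_cancel, exp_zero]
    have hPdet : v P.det < 1 := by
      have : P.det = (∏ i, RatFunc.X ^ (-(d i : ℤ))) * b.det a := by
        rw [Module.Basis.det_apply, ← Matrix.det_mul_row]
        rfl
      have hprod : ∏ i, (RatFunc.X : RatFunc k) ^ (-(d i : ℤ)) = RatFunc.X ^ (-(N + 1 : ℤ)) := by
        simp_rw [zpow_neg, zpow_natCast, Finset.prod_inv_distrib, Finset.prod_pow_eq_pow_sum, hd]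
        norm_cast
      rw [this, map_mul, hdet, mul_one, hprod, hvX, ← exp_zero, exp_lt_exp]
      omega
    choose c hc using fun l i => exists_inftyValuation_sub_C_lt_one (hP l i)
    let c' : Matrix ι ι k := fun l i => c l i
    have hc' : c'.det = 0 := by
      have h1 : v (P.det - (c'.map (RatFunc.C : k →+* RatFunc k)).det) < 1 :=
        v.det_sub_det_lt_one (fun l i => inftyValuation_C_le_one _) hc
      refine inftyValuation_C_lt_one ?_
      rw [RingHom.map_det, ← sub_sub_cancel P.det ((RatFunc.C : k →+* RatFunc k).mapMatrix c').det]
      exact v.map_sub_lt hPdet h1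
    obtain ⟨w, hw0, hw⟩ := Matrix.exists_mulVec_eq_zero_iff.2 hc'
    obtain ⟨i₀, hi₀⟩ := Function.ne_iff.1 hw0
    -- Maximality of `d j` on the support of `w` keeps the exponents `d j - d i` honest there;
    -- elsewhere the truncated subtraction is multiplied by `w i = 0`.
    obtain ⟨j, hj, hjmax⟩ := Finset.exists_max_image (Finset.univ.filter fun i => w i ≠ 0) d
      ⟨i₀, by simpa using hi₀⟩
    have hwj : w j ≠ 0 := by simpa using hj
    let q : ι → k[X] := fun i => Polynomial.C (w i) * Polynomial.X ^ (d j - d i)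
    have hq : ∀ i, algebraMap k[X] (RatFunc k) (q i) =
        RatFunc.X ^ (d j : ℤ) * (RatFunc.C (w i) * RatFunc.X ^ (-(d i : ℤ))) := fun i => by
      rcases eq_or_ne (w i) 0 with h0 | h0
      · simp [q, h0]
      · have hle : d i ≤ d j := hjmax i (by simpa using h0)
        rw [map_mul, map_pow, algebraMap_C, algebraMap_X, mul_left_comm, ← zpow_add₀ hX,
          ← zpow_natCast, Nat.cast_sub hle, sub_eq_add_neg]
    let z : M := ∑ i, q i • a i
    have hzA : z ∈ A := A.sum_mem fun i _ => A.smul_mem _ (haA i)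
    have hzrepr : ∀ l, b.repr z l =
        ∑ i, algebraMap k[X] (RatFunc k) (q i) • b.toMatrix a l i := fun l => by
      simp only [z, map_sum, Finsupp.coe_finsetSum, Finset.sum_apply,
        Module.Basis.toMatrix_apply]
      refine Finset.sum_congr rfl fun i _ => ?_
      rw [← algebraMap_smul (RatFunc k) (q i) (a i), map_smul, Finsupp.smul_apply]
    have hz : ∀ l, v (b.repr z l) < exp (d j : ℤ) := fun l => by
      have h1 : b.repr z l = RatFunc.X ^ (d j : ℤ) * ∑ i, RatFunc.C (w i) * (P l i - RatFunc.C (c l i)) := by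
        have h2 : ∑ i, RatFunc.C (w i) * RatFunc.C (c l i) = (0 : RatFunc k) := by
          simp_rw [← map_mul, ← map_sum]
          rw [← map_zero (RatFunc.C : k →+* RatFunc k)]
          congr 1
          have := congrFun hw l
          simpa [Matrix.mulVec, dotProduct, c', mul_comm] using this
        simp_rw [hzrepr, hq, mul_sub, Finset.sum_sub_distrib, h2, sub_zero, Finset.mul_sum, P,
          smul_eq_mul, mul_assoc]
      rw [h1, map_mul, hvX]
      refine mul_lt_of_lt_one_right (by simp) ?_
      refine v.map_sum_lt one_ne_zero fun i _ => ?_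
      rw [map_mul]
      exact mul_lt_one_of_nonneg_of_lt_one_right (inftyValuation_C_le_one _) zero_le (hc l i)
    have hdet' : v (b.det (Function.update a j z)) = 1 := by
      have h1 : b.det (Function.update a j z) = RatFunc.C (w j) * b.det a := by
        rw [Module.Basis.det_apply, Module.Basis.det_apply, Module.Basis.toMatrix_update]
        have h2 : (b.repr z : ι → RatFunc k) = fun l =>
            ∑ i, algebraMap k[X] (RatFunc k) (q i) • b.toMatrix a l i := funext hzrepr
        rw [h2, Matrix.det_updateCol_sum]
        simp [q, algebraMap_C]
      rw [h1, map_mul, hdet, mul_one]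
      exact inftyValuation.C k hwj
    -- If `d j = 0`, the new vector has only coordinates of negative degree, so it vanishes,
    -- contradicting the determinant. Otherwise the bound `d j` drops by one.
    rcases Nat.eq_zero_or_pos (d j) with h0 | h0
    · have hz0 : z = 0 := hA z hzA fun i => by simpa [h0] using hz i
      rw [hz0, (b.det).map_update_zero, map_zero] at hdet'
      exact absurd hdet' zero_ne_one
    · refine ih (Function.update a j z) (Function.update d j (d j - 1)) ?_ ?_ ?_ hdet'
      · rw [Finset.sum_update_of_mem (Finset.mem_univ j)]
        have := Finset.add_sum_erase Finset.univ d (Finset.mem_univ j)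
        rw [Finset.sdiff_singleton_eq_erase]
        omega
      · intro i
        rcases eq_or_ne i j with rfl | hij
        · simpa using hzA
        · simpa [hij] using haA i
      · intro i l
        rcases eq_or_ne i j with rfl | hij
        · simp only [Function.update_self]
          rcases eq_or_ne (v (b.repr z l)) 0 with h | h
          · rw [h]
            exact zero_le
          · have h3 := hz l
            rw [← exp_log h, exp_lt_exp] at h3
            rw [← exp_log h, exp_le_exp]
            omega
        · simpa [hij] using had i l

end RatFuncInfty

/-! ### Unramified extensions have unit discriminant -/

open scoped nonZeroDivisors

section Discriminant

variable (R K L S : Type*) [CommRing R] [IsDedekindDomain R] [Field K] [Algebra R K]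
  [IsFractionRing R K] [Field L] [Algebra K L] [FiniteDimensional K L] [Algebra.IsSeparable K L]
  [Algebra R L] [IsScalarTower R K L] [CommRing S] [Algebra R S] [Algebra S L]
  [IsScalarTower R S L] [IsIntegralClosure S R L]

include K L in
-- A maximal ideal containing the different would divide it, and so be ramified.
theorem differentIdeal_eq_top_of_isUnramifiedAt [IsDedekindDomain S] [Module.IsTorsionFree R S]
    (h : ∀ (P : Ideal S) (_ : P.IsMaximal), Algebra.IsUnramifiedAt R P) :
    differentIdeal R S = ⊤ := by
  have : Module.Finite R S := IsIntegralClosure.finite R K L S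
  have : IsFractionRing S L := IsIntegralClosure.isFractionRing_of_finite_extension R K L S
  let : Algebra (FractionRing R) (FractionRing S) := FractionRing.liftAlgebra _ _
  have : Algebra.IsSeparable (FractionRing R) (FractionRing S) := by
    refine Algebra.IsSeparable.of_equiv_equiv (FractionRing.algEquiv R K).symm.toRingEquiv
      (FractionRing.algEquiv S L).symm.toRingEquiv ?_
    apply IsLocalization.ringHom_ext R⁰
    ext
    simp only [RingHom.coe_comp, RingHom.coe_coe,
      AlgEquiv.coe_ringEquiv, Function.comp_apply, AlgEquiv.commutes,
      ← IsScalarTower.algebraMap_apply]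
    rw [IsScalarTower.algebraMap_apply R S L, AlgEquiv.commutes, ← IsScalarTower.algebraMap_apply]
  by_contra htop
  obtain ⟨P, hP, hle⟩ := Ideal.exists_le_maximal _ htop
  have := hP.isPrime
  exact not_dvd_differentIdeal_iff.2 (h P hP) (Ideal.dvd_iff_le.2 hle)

include K L in
/-- If `S` is unramified over `R`, then the discriminant of any `R`-basis of `S` is a unit. -/
theorem isUnit_discr_of_isUnramifiedAt [IsDomain S] [Module.IsTorsionFree R S]
    (h : ∀ (P : Ideal S) (_ : P.IsMaximal), Algebra.IsUnramifiedAt R P)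
    {ι : Type*} [Fintype ι] [DecidableEq ι] (b : Module.Basis ι R S) :
    IsUnit (Algebra.discr R b) := by
  have : IsDedekindDomain S := IsIntegralClosure.isDedekindDomain R K L S
  have : Module.Finite R S := .of_basis b
  have : Module.Free R S := .of_basis b
  have : IsFractionRing S L := IsIntegralClosure.isFractionRing_of_finite_extension R K L S
  have : IsLocalization (Algebra.algebraMapSubmonoid S R⁰) L :=
    IsIntegralClosure.isLocalization R K L S
  have hdiff := differentIdeal_eq_top_of_isUnramifiedAt R K L S h
  -- With trivial different, `S` is its own dual for the trace form; the trace dual basis then lies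
  -- in `S` and provides an inverse of the trace matrix over `R`.
  have hdual : FractionalIdeal.dual R K (1 : FractionalIdeal S⁰ L) = 1 := by
    have h1 := coeIdeal_differentIdeal R K L S
    rw [hdiff, FractionalIdeal.coeIdeal_top] at h1
    rw [← inv_inv (FractionalIdeal.dual R K (1 : FractionalIdeal S⁰ L)), ← h1, inv_one]
  let b' : Module.Basis ι K L := b.localizationLocalization K R⁰ L
  have hb' : ∀ i, b' i = algebraMap S L (b i) := fun i =>
    b.localizationLocalization_apply K R⁰ L i
  have hs : ∀ j, ∃ s : S, algebraMap S L s = b'.traceDual j := fun j => by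
    have hmem : b'.traceDual j ∈ (1 : FractionalIdeal S⁰ L) := by
      rw [← hdual, FractionalIdeal.mem_dual (one_ne_zero (α := FractionalIdeal S⁰ L))]
      intro a ha
      obtain ⟨a, rfl⟩ := (FractionalIdeal.mem_one_iff _).1 ha
      refine ⟨b.repr a j, ?_⟩
      rw [Algebra.traceForm_apply]
      have : algebraMap S L a = ∑ i, algebraMap R K (b.repr a i) • b' i := by
        conv_lhs => rw [← b.sum_repr a, map_sum]
        refine Finset.sum_congr rfl fun i _ => ?_
        rw [hb', algebraMap_smul, Algebra.smul_def, map_mul, Algebra.smul_def,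
          ← IsScalarTower.algebraMap_apply]
      rw [this, Finset.mul_sum, map_sum]
      simp_rw [mul_smul_comm, map_smul, b'.trace_traceDual_mul]
      simp
    exact (FractionalIdeal.mem_one_iff _).1 hmem
  choose s hs using hs
  have htr : ∀ i j, Algebra.trace R S (b i * s j) = if i = j then 1 else 0 := fun i j => by
    apply IsFractionRing.injective R K
    rw [← Algebra.trace_localization R R⁰ (Sₘ := L), map_mul, hs, ← hb', b'.trace_mul_traceDual]
    split_ifs <;> simp
  have hmul : Algebra.traceMatrix R b * b.toMatrix s = 1 := by
    ext i j
    rw [Matrix.mul_apply, Matrix.one_apply, ← htr i j]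
    conv_rhs => rw [← b.sum_repr (s j)]
    rw [Finset.mul_sum, map_sum]
    refine Finset.sum_congr rfl fun l _ => ?_
    rw [Algebra.traceMatrix_apply, Algebra.traceForm_apply, Module.Basis.toMatrix_apply,
      mul_smul_comm, map_smul, smul_eq_mul, mul_comm]
  rw [Algebra.discr_def]
  exact (Matrix.isUnit_iff_isUnit_det _).1 (IsUnit.of_mul_eq_one _ hmul)

end Discriminant

/-! ### Triviality of unramified extensions of `k(t)` with a rational place at infinity -/

section FunctionField

open RatFunc
open scoped Polynomial

variable {k M R S T : Type*} [Field k] [DecidableEq (RatFunc k)] [Field M] [Algebra (RatFunc k) M]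
  [FiniteDimensional (RatFunc k) M] [Algebra.IsSeparable (RatFunc k) M]
  [Algebra k[X] M] [IsScalarTower k[X] (RatFunc k) M]
  [CommRing R] [IsDomain R] [IsPrincipalIdealRing R] [IsLocalRing R]
  [Algebra R (RatFunc k)]
  [IsFractionRing R (RatFunc k)] [Algebra R M] [IsScalarTower R (RatFunc k) M]
  [CommRing S] [IsDomain S] [Algebra k[X] S] [Algebra S M] [IsScalarTower k[X] S M]
  [IsIntegralClosure S k[X] M]
  [CommRing T] [IsDomain T] [Algebra R T] [Algebra T M] [IsScalarTower R T M]
  [IsIntegralClosure T R M]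

/-- The norm is a polynomial, and a nonzero polynomial does not have negative degree. -/
theorem eq_zero_of_isIntegral_of_inftyValuation_norm_lt_one {x : M} (hx : IsIntegral k[X] x)
    (h : inftyValuation k (Algebra.norm (RatFunc k) x) < 1) : x = 0 := by
  obtain ⟨p, hp⟩ := IsIntegrallyClosed.isIntegral_iff.1 (Algebra.isIntegral_norm (RatFunc k) hx)
  rw [← Algebra.norm_eq_zero_iff (R := RatFunc k), ← hp]
  by_contra hne
  rw [← hp] at h
  exact absurd h (not_lt.2 (one_le_inftyValuation_algebraMap fun h0 => hne (by rw [h0, map_zero])))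

/-- A separable extension of `k(t)` that is unramified everywhere and has a place of degree one
above the infinite place is trivial. -/
theorem finrank_eq_one_of_isUnramifiedAt (hR : (inftyValuation k).Integers R)
    (hS : ∀ (P : Ideal S) (_ : P.IsMaximal), Algebra.IsUnramifiedAt k[X] P)
    (hT : ∀ (P : Ideal T) (_ : P.IsMaximal), Algebra.IsUnramifiedAt R P)
    (P : Ideal T) [P.IsMaximal] (hP : ∀ x : T, ∃ r : R, x - algebraMap R T r ∈ P) :
    Module.finrank (RatFunc k) M = 1 := by
  classical
  have : FaithfulSMul k[X] M := (faithfulSMul_iff_algebraMap_injective _ _).2 <| by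
    rw [IsScalarTower.algebraMap_eq k[X] (RatFunc k) M]
    exact (algebraMap (RatFunc k) M).injective.comp (IsFractionRing.injective k[X] (RatFunc k))
  have : FaithfulSMul R M := (faithfulSMul_iff_algebraMap_injective _ _).2 <| by
    rw [IsScalarTower.algebraMap_eq R (RatFunc k) M]
    exact (algebraMap (RatFunc k) M).injective.comp (IsFractionRing.injective R (RatFunc k))
  have : Module.IsTorsionFree k[X] S := IsIntegralClosure.isTorsionFree k[X] M
  have : Module.IsTorsionFree R T := IsIntegralClosure.isTorsionFree R M
  have : Module.Free k[X] S := IsIntegralClosure.module_free k[X] (RatFunc k) M S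
  have : Module.Free R T := IsIntegralClosure.module_free R (RatFunc k) M T
  have : Module.Finite k[X] S := IsIntegralClosure.finite k[X] (RatFunc k) M S
  have : Module.Finite R T := IsIntegralClosure.finite R (RatFunc k) M T
  have : IsLocalization (Algebra.algebraMapSubmonoid S k[X]⁰) M :=
    IsIntegralClosure.isLocalization k[X] (RatFunc k) M S
  have : IsLocalization (Algebra.algebraMapSubmonoid T R⁰) M :=
    IsIntegralClosure.isLocalization R (RatFunc k) M T
  have : IsDedekindDomain T := IsIntegralClosure.isDedekindDomain R (RatFunc k) M T
  set v := inftyValuation k with hv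
  have hint : ∀ {f : RatFunc k}, IsIntegral R f → v f ≤ 1 := fun {f} hf => by
    obtain ⟨r, rfl⟩ := IsIntegrallyClosed.isIntegral_iff.1 hf
    exact hR.map_le_one r
  have hunitR : ∀ r : R, IsUnit r ↔ v (algebraMap R (RatFunc k) r) = 1 := fun r =>
    hR.isUnit_iff_valuation_eq_one
  let n := Module.finrank (RatFunc k) M
  let eS : Module.Basis (Fin n) k[X] S := (Module.finBasis k[X] S).reindex
    (finCongr (IsIntegralClosure.rank k[X] (RatFunc k) M S))
  let eT : Module.Basis (Fin n) R T := (Module.finBasis R T).reindex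
    (finCongr (IsIntegralClosure.rank R (RatFunc k) M T))
  let a : Module.Basis (Fin n) (RatFunc k) M := eS.localizationLocalization (RatFunc k) k[X]⁰ M
  let b : Module.Basis (Fin n) (RatFunc k) M := eT.localizationLocalization (RatFunc k) R⁰ M
  have ha : ∀ i, a i = algebraMap S M (eS i) := fun i =>
    eS.localizationLocalization_apply (RatFunc k) k[X]⁰ M i
  have hvb : v (Algebra.discr (RatFunc k) b) = 1 := by
    rw [Algebra.discr_localizationLocalization, ← hunitR]
    exact isUnit_discr_of_isUnramifiedAt R (RatFunc k) M T hT eT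
  have hva : v (Algebra.discr (RatFunc k) a) = 1 := by
    rw [Algebra.discr_localizationLocalization]
    obtain ⟨c, hc, hc'⟩ := Polynomial.isUnit_iff.1
      (isUnit_discr_of_isUnramifiedAt k[X] (RatFunc k) M S hS eS)
    rw [← hc', algebraMap_C]
    exact inftyValuation.C k hc.ne_zero
  -- The two discriminants have valuation 1 and differ by the square of this determinant.
  have hdet : v (b.det a) = 1 := by
    have h1 : Algebra.discr (RatFunc k) a = b.det a ^ 2 * Algebra.discr (RatFunc k) b := by
      rw [Module.Basis.det_apply, ← Algebra.discr_of_matrix_vecMul]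
      congr 1
      exact (b.toMatrix_map_vecMul a).symm
    have h2 := congrArg v h1
    rw [hva, map_mul, hvb, mul_one, map_pow] at h2
    exact (pow_eq_one_iff_of_nonneg zero_le two_ne_zero).1 h2.symm
  have hbT : ∀ y : M, (∀ i, v (b.repr y i) ≤ 1) ↔ ∃ t : T, algebraMap T M t = y := by
    intro y
    constructor
    · intro hy
      choose r hr using fun i => hR.exists_of_le_one (hy i)
      refine ⟨∑ i, r i • eT i, ?_⟩
      conv_rhs => rw [← b.sum_repr y]
      rw [map_sum]
      refine Finset.sum_congr rfl fun i _ => ?_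
      rw [← hr, algebraMap_smul, Algebra.smul_def, map_mul, Algebra.smul_def,
        ← IsScalarTower.algebraMap_apply, eT.localizationLocalization_apply (RatFunc k) R⁰ M]
    · rintro ⟨t, rfl⟩ i
      rw [eT.localizationLocalization_repr_algebraMap (RatFunc k) R⁰ M]
      exact hR.map_le_one _
  have hnorm : ∀ t : T, v (Algebra.norm (RatFunc k) (algebraMap T M t)) ≤ 1 := fun t =>
    hint (Algebra.isIntegral_norm (RatFunc k) ((IsIntegralClosure.isIntegral R M t).algebraMap))
  let A : Submodule k[X] M := (Algebra.linearMap S M).restrictScalars k[X] |>.range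
  have hAint : ∀ x ∈ A, IsIntegral k[X] x := by
    rintro _ ⟨s, rfl⟩
    exact (IsIntegralClosure.isIntegral k[X] M s).algebraMap
  have hnpos : 0 < n := Module.finrank_pos
  -- Here `X • x` still lies in `T`, so `X ^ n` times the norm of `x` has degree at most 0; as `n >
  -- 0`, the norm of `x` has negative degree.
  have hA0 : ∀ x ∈ A, (∀ i, v (b.repr x i) < 1) → x = 0 := by
    intro x hx hlt
    have hX : (X : RatFunc k) ≠ 0 := RatFunc.X_ne_zero
    obtain ⟨t, ht⟩ := (hbT ((X : RatFunc k) • x)).1 fun i => by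
      rw [map_smul, Finsupp.smul_apply, smul_eq_mul, map_mul, inftyValuation.X]
      rcases eq_or_ne (v (b.repr x i)) 0 with h | h
      · rw [h, mul_zero]
        exact zero_le
      · have h3 := hlt i
        rw [← WithZero.exp_log h, ← WithZero.exp_zero, WithZero.exp_lt_exp] at h3
        rw [← WithZero.exp_log h, ← WithZero.exp_add, ← WithZero.exp_zero, WithZero.exp_le_exp]
        omega
    refine eq_zero_of_isIntegral_of_inftyValuation_norm_lt_one (hAint x hx) ?_
    have h1 := hnorm t
    rw [ht, Algebra.smul_def, map_mul, Algebra.norm_algebraMap, map_mul, map_pow,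
      inftyValuation.X] at h1
    by_contra hge
    refine absurd h1 (not_le.2 ?_)
    refine lt_of_lt_of_le ?_ (le_mul_of_one_le_right' (not_lt.1 hge))
    refine one_lt_pow₀ ?_ hnpos.ne'
    rw [← WithZero.exp_zero, WithZero.exp_lt_exp]
    exact zero_lt_one
  obtain ⟨d, hd⟩ : ∃ d : Fin n → ℕ, ∀ i j, v (b.repr (a i) j) ≤ WithZero.exp (d i : ℤ) := by
    -- A crude bound on the degrees; its size only affects the length of the induction.
    refine ⟨fun i => ∑ j, (WithZero.log (v (b.repr (a i) j))).toNat, fun i j => ?_⟩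
    rcases eq_or_ne (v (b.repr (a i) j)) 0 with h | h
    · rw [h]
      exact zero_le
    · conv_lhs => rw [← WithZero.exp_log h]
      rw [WithZero.exp_le_exp]
      refine (Int.self_le_toNat _).trans ?_
      exact_mod_cast Finset.single_le_sum
        (f := fun j => (WithZero.log (v (b.repr (a i) j))).toNat) (fun _ _ => Nat.zero_le _)
        (Finset.mem_univ j)
  obtain ⟨a', ha'A, ha'T, ha'det⟩ := exists_reduced_family b A hA0 _ a d rfl
    (fun i => ⟨eS i, (ha i).symm⟩) hd hdet
  have hlocal : ∀ r : R, v (algebraMap R (RatFunc k) r) < 1 → algebraMap R T r ∈ P := by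
    intro r hr
    have hmax : (P.comap (algebraMap R T)).IsMaximal :=
      Ideal.isMaximal_comap_of_isIntegral_of_isMaximal P
    have : r ∈ IsLocalRing.maximalIdeal R := by
      rw [IsLocalRing.mem_maximalIdeal, mem_nonunits_iff, hunitR]
      exact hr.ne
    rw [← IsLocalRing.eq_maximalIdeal hmax] at this
    exact this
  -- Modulo `P` the element `a' i` is a constant `c`. The difference is integral over `k[X]`, and
  -- its norm to `R` lies over `P`, so is a nonunit of negative degree; hence the difference is
  -- zero.
  have hconst : ∀ i, ∃ c : k, a' i = algebraMap (RatFunc k) M (C c) := by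
    intro i
    obtain ⟨t, ht⟩ := (hbT (a' i)).1 (ha'T i)
    obtain ⟨r, hr⟩ := hP t
    obtain ⟨c, hc⟩ := exists_inftyValuation_sub_C_lt_one (hR.map_le_one r)
    obtain ⟨r', hr'⟩ := hR.exists_of_le_one (inftyValuation_C_le_one c)
    have hmem : t - algebraMap R T r' ∈ P := by
      have : t - algebraMap R T r' = (t - algebraMap R T r) + algebraMap R T (r - r') := by
        rw [map_sub]
        ring
      rw [this]
      refine P.add_mem hr (hlocal _ ?_)
      rw [map_sub, hr']
      exact hc
    refine ⟨c, sub_eq_zero.1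
      (eq_zero_of_isIntegral_of_inftyValuation_norm_lt_one (k := k) ?_ ?_)⟩
    · refine (hAint _ (ha'A i)).sub ?_
      rw [← algebraMap_C, ← IsScalarTower.algebraMap_apply]
      exact isIntegral_algebraMap
    · have hx : a' i - algebraMap (RatFunc k) M (C c) = algebraMap T M (t - algebraMap R T r') := by
        rw [map_sub, ht, ← IsScalarTower.algebraMap_apply, ← hr', ← IsScalarTower.algebraMap_apply]
      rw [hx, ← Algebra.algebraMap_intNorm (A := R)]
      refine lt_of_le_of_ne (hR.map_le_one _) fun h1 => ?_
      rw [← hunitR] at h1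
      have hmem' := P.mem_of_dvd (Algebra.dvd_algebraMap_intNorm_self R T _) hmem
      exact Ideal.IsPrime.ne_top' (Ideal.eq_top_of_isUnit_mem _ hmem' (h1.map _))
  refine le_antisymm (finrank_le_one (1 : M) fun w => ?_) hnpos
  have hspan : Submodule.span (RatFunc k) (Set.range a') = ⊤ := by
    refine ((b.is_basis_iff_det).2 (IsUnit.mk0 _ fun h0 => ?_)).2
    rw [h0, map_zero] at ha'det
    exact zero_ne_one ha'det
  have hle : Submodule.span (RatFunc k) (Set.range a') ≤ Submodule.span (RatFunc k) {1} := by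
    rw [Submodule.span_le]
    rintro _ ⟨i, rfl⟩
    obtain ⟨c, hc⟩ := hconst i
    exact Submodule.mem_span_singleton.2 ⟨C c, by rw [hc, Algebra.algebraMap_eq_smul_one]⟩
  exact Submodule.mem_span_singleton.1 (hle (hspan ▸ Submodule.mem_top))

end FunctionField

/-! ### Dictionary between valuation subrings and primes -/

open IsDedekindDomain

section Places

variable {A K U F : Type*} [CommRing A] [IsDedekindDomain A] [Field K] [Algebra A K]
  [IsFractionRing A K] [CommRing U] [IsDedekindDomain U] [Field F] [Algebra U F]
  [IsFractionRing U F] [Algebra K F] [Algebra A F] [IsScalarTower A K F] [Algebra A U]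
  [IsScalarTower A U F] [Module.IsTorsionFree A U]

theorem ValuationSubring.valuation_ne_top_of_heightOneSpectrum (w : HeightOneSpectrum U) :
    (w.valuation F).valuationSubring ≠ ⊤ := by
  obtain ⟨π, hπ⟩ := w.valuation_exists_uniformizer F
  intro h
  have hmem : π⁻¹ ∈ (w.valuation F).valuationSubring := h ▸ ValuationSubring.mem_top _
  rw [Valuation.mem_valuationSubring_iff, map_inv₀, hπ, ← WithZero.exp_neg, ← WithZero.exp_zero,
    WithZero.exp_le_exp] at hmem
  omega

variable (v : HeightOneSpectrum A) (w : HeightOneSpectrum U) [w.asIdeal.LiesOver v.asIdeal]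

include v in
theorem comap_valuationSubring_liesOver :
    (w.valuation F).valuationSubring.comap (algebraMap K F) =
      (v.valuation K).valuationSubring := by
  ext x
  rw [ValuationSubring.mem_comap, Valuation.mem_valuationSubring_iff,
    Valuation.mem_valuationSubring_iff, ← HeightOneSpectrum.valuation_liesOver F v w]
  exact pow_le_one_iff (Ideal.IsDedekindDomain.ramificationIdx'_ne_zero_of_liesOver _ v.ne_bot)

variable (K F) in
include v in
theorem ramificationIdx_eq_one_of_isUnramifiedPlace
    (h : IsUnramifiedPlace K (w.valuation F).valuationSubring) :
    w.asIdeal.ramificationIdx A = 1 := by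
  rw [← Ideal.ramificationIdx'_eq_ramificationIdx v.asIdeal w.asIdeal v.ne_bot]
  set e := v.asIdeal.ramificationIdx' w.asIdeal with he
  have he0 : e ≠ 0 := Ideal.IsDedekindDomain.ramificationIdx'_ne_zero_of_liesOver _ v.ne_bot
  let B := (w.valuation F).valuationSubring
  -- Elements from `K` have `w`-valuations that are `e`-th powers, so the maximal ideal below lands
  -- in `J`. As it generates the maximal ideal of `B`, a uniformizer is in `J`, forcing `e ≤ 1`.
  let J : Ideal B :=
    { carrier := {x | w.valuation F x ≤ WithZero.exp (-(e : ℤ))}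
      add_mem' := fun {x y} hx hy => (w.valuation F).map_add_le hx hy
      zero_mem' := by
        change w.valuation F ((0 : B) : F) ≤ _
        simp
      smul_mem' := fun c x hx => by
        change w.valuation F ((c : F) * x) ≤ _
        rw [map_mul]
        exact (mul_le_of_le_one_left' c.2).trans hx }
  have hle : IsLocalRing.maximalIdeal B ≤ J := by
    rw [← h.map_maximalIdeal, Ideal.map_le_iff_le_comap]
    intro x hx
    change w.valuation F (algebraMap K F x) ≤ _
    have hlt : w.valuation F (algebraMap K F x) < 1 := by
      have := (((IsLocalRing.local_hom_TFAE (placeBelowHom K B)).out 0 2 :)).1 inferInstance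
      exact (Valuation.mem_maximalIdeal_iff F (w.valuation F)).1 (this (Ideal.mem_map_of_mem _ hx))
    rw [← HeightOneSpectrum.valuation_liesOver F v w, ← he] at hlt ⊢
    have hlt' : v.valuation K x < 1 := (pow_lt_one_iff he0).1 hlt
    rcases eq_or_ne (v.valuation K x) 0 with h0 | h0
    · rw [h0, zero_pow he0]
      exact zero_le
    · rw [← WithZero.exp_log h0, ← WithZero.exp_zero, WithZero.exp_lt_exp] at hlt'
      rw [← WithZero.exp_log h0, ← WithZero.exp_nsmul, WithZero.exp_le_exp, nsmul_eq_mul]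
      nlinarith
  obtain ⟨π, hπ⟩ := w.valuation_exists_uniformizer F
  have hπ1 : w.valuation F π < 1 := by
    rw [hπ, ← WithZero.exp_zero, WithZero.exp_lt_exp]
    omega
  have hπJ : (⟨π, hπ1.le⟩ : B) ∈ J := hle ((Valuation.mem_maximalIdeal_iff F (w.valuation F)).2 hπ1)
  have : WithZero.exp (-1 : ℤ) ≤ WithZero.exp (-(e : ℤ)) := hπ ▸ hπJ
  rw [WithZero.exp_le_exp] at this
  omega

variable (K F) in
include v in
-- Surjectivity provides a representative in the valuation ring of `v`, and every element of that
-- ring is congruent to one of `A` modulo its maximal ideal.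
theorem exists_sub_mem_of_surjective_placeResidueHom
    (h : Function.Surjective (placeResidueHom K (w.valuation F).valuationSubring)) (x : U) :
    ∃ a : A, x - algebraMap A U a ∈ w.asIdeal := by
  set e := v.asIdeal.ramificationIdx' w.asIdeal with he
  have he0 : e ≠ 0 := Ideal.IsDedekindDomain.ramificationIdx'_ne_zero_of_liesOver _ v.ne_bot
  let B := (w.valuation F).valuationSubring
  obtain ⟨z, hz⟩ := h (IsLocalRing.residue B ⟨algebraMap U F x, w.valuation_le_one x⟩)
  obtain ⟨y, rfl⟩ := IsLocalRing.residue_surjective z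
  have hz' : IsLocalRing.residue B (placeBelowHom K B y) =
    IsLocalRing.residue B ⟨algebraMap U F x, w.valuation_le_one x⟩ := hz
  rw [← sub_eq_zero, ← map_sub, IsLocalRing.residue_eq_zero_iff] at hz'
  have hlt : w.valuation F (algebraMap K F y - algebraMap U F x) < 1 :=
    (Valuation.mem_maximalIdeal_iff F (w.valuation F)).1 hz'
  have hy : v.valuation K (y : K) ≤ 1 := by
    have : (y : K) ∈ (v.valuation K).valuationSubring := by
      rw [← comap_valuationSubring_liesOver (F := F) v w]
      exact y.2
    exact this
  obtain ⟨a, ha⟩ := v.exists_valuation_sub_lt_of_integer hy (1 : (WithZero (Multiplicative ℤ))ˣ)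
  refine ⟨a, ?_⟩
  rw [← HeightOneSpectrum.valuation_lt_one_iff_mem (K := F)]
  change w.valuation F (algebraMap U F (x - algebraMap A U a)) < 1
  rw [map_sub, ← IsScalarTower.algebraMap_apply, IsScalarTower.algebraMap_apply A K F]
  have ha' : w.valuation F (algebraMap K F (y - algebraMap A K a)) < 1 := by
    rw [← HeightOneSpectrum.valuation_liesOver F v w, ← he, (v.valuation K).map_sub_swap]
    refine (pow_lt_one_iff he0).2 ?_
    simpa using ha
  have heq : algebraMap U F x - algebraMap K F (algebraMap A K a) =
      algebraMap K F (y - algebraMap A K a) - (algebraMap K F y - algebraMap U F x) := by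
    rw [map_sub (algebraMap K F)]
    ring
  rw [heq]
  exact (w.valuation F).map_sub_lt ha' hlt

variable (K F) in
include v in
theorem inertiaDeg_eq_one_of_surjective_placeResidueHom
    (h : Function.Surjective (placeResidueHom K (w.valuation F).valuationSubring)) :
    w.asIdeal.inertiaDeg A = 1 := by
  have := v.isMaximal
  have := w.isMaximal
  let := Ideal.Quotient.field v.asIdeal
  rw [Ideal.inertiaDeg_eq_of_isMaximal v.asIdeal w.asIdeal]
  have : Nontrivial (U ⧸ w.asIdeal) := Ideal.Quotient.nontrivial_iff.2 w.isPrime.ne_top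
  refine finrank_eq_one (1 : U ⧸ w.asIdeal) one_ne_zero fun x => ?_
  obtain ⟨x, rfl⟩ := Ideal.Quotient.mk_surjective x
  obtain ⟨a, ha⟩ := exists_sub_mem_of_surjective_placeResidueHom K F v w h x
  refine ⟨Ideal.Quotient.mk _ a, ?_⟩
  rw [Algebra.smul_def, mul_one]
  exact (Ideal.Quotient.eq.2 ha).symm

end Places

/-! ### Coprimality in towers -/

section Tower

/-- This is the identity `e f g = |G|` for Galois extensions. -/
theorem ramificationIdx_mul_inertiaDeg_dvd_card (R Q M S : Type*) [CommRing R] [IsDedekindDomain R]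
    [Field Q] [Algebra R Q] [IsFractionRing R Q] [Field M] [Algebra Q M] [FiniteDimensional Q M]
    [IsGalois Q M] [Algebra R M] [IsScalarTower R Q M] [CommRing S] [IsDomain S] [Algebra R S]
    [Algebra S M] [IsScalarTower R S M] [IsIntegralClosure S R M] [Module.IsTorsionFree R S]
    (P : Ideal S) [P.IsPrime] :
    P.ramificationIdx R * P.inertiaDeg R ∣ Nat.card Gal(M/Q) := by
  have : IsFractionRing S M := IsIntegralClosure.isFractionRing_of_finite_extension R Q M S
  have : Module.Finite R S := IsIntegralClosure.finite R Q M S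
  let : MulSemiringAction Gal(M/Q) S := IsIntegralClosure.MulSemiringAction R Q M S
  have : IsGaloisGroup Gal(M/Q) R S := IsGaloisGroup.of_isFractionRing _ _ _ Q M
  have h := Ideal.ncard_primesOver_mul_ramificationIdxIn_mul_inertiaDegIn (P.under R) S Gal(M/Q)
  rw [Ideal.ramificationIdxIn_eq_ramificationIdx (P.under R) P Gal(M/Q),
    Ideal.inertiaDegIn_eq_inertiaDeg (P.under R) P Gal(M/Q)] at h
  exact ⟨_, by rw [← h, mul_comm]⟩

variable (R Q K M F A S U : Type*) [CommRing R] [IsDedekindDomain R]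
  [Field Q] [Algebra R Q] [IsFractionRing R Q]
  [Field K] [Algebra Q K] [FiniteDimensional Q K] [IsGalois Q K] [Algebra R K]
  [IsScalarTower R Q K]
  [Field M] [Algebra Q M] [FiniteDimensional Q M] [IsGalois Q M] [Algebra R M]
  [IsScalarTower R Q M]
  [Field F] [Algebra Q F] [FiniteDimensional Q F] [Algebra.IsSeparable Q F] [Algebra R F]
  [IsScalarTower R Q F] [Algebra K F]
  [CommRing A] [IsDomain A] [Algebra R A] [Algebra A K] [IsScalarTower R A K]
  [IsIntegralClosure A R K]
  [CommRing S] [IsDomain S] [Algebra R S] [Algebra S M] [IsScalarTower R S M]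
  [IsIntegralClosure S R M]
  [CommRing U] [IsDomain U] [Algebra R U] [Algebra U F] [IsScalarTower R U F]
  [IsIntegralClosure U R F]
  [Algebra A U] [IsScalarTower R A U] [Algebra A F] [IsScalarTower A K F] [IsScalarTower A U F]
  [Algebra S U] [IsScalarTower R S U] [FaithfulSMul S U]
  [Module.IsTorsionFree R S]

include Q K F A U in
-- Take `w` over `P` in the larger ring `U`, and `v` below `w` in `A`. By multiplicativity, `e(P)`
-- divides `e(w/v) e(v)`. If `e(w/v) = 1`, then `e(P)` divides both coprime group orders. Inertia
-- degrees behave alike.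
theorem exists_heightOneSpectrum_above (hcop : (Nat.card Gal(M/Q)).Coprime (Nat.card Gal(K/Q)))
    (P : Ideal S) [P.IsPrime] (hP : P ≠ ⊥) :
    ∃ (_ : IsDedekindDomain A) (_ : IsDedekindDomain U) (_ : IsFractionRing A K)
      (_ : IsFractionRing U F) (_ : Module.IsTorsionFree A U)
      (v : HeightOneSpectrum A) (w : HeightOneSpectrum U), w.asIdeal.LiesOver v.asIdeal ∧
      v.asIdeal.under R = P.under R ∧
      (w.asIdeal.ramificationIdx A = 1 → P.ramificationIdx R = 1) ∧
      (w.asIdeal.inertiaDeg A = 1 → P.inertiaDeg R = 1) := by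
  have hA : IsDedekindDomain A := IsIntegralClosure.isDedekindDomain R Q K A
  have hS : IsDedekindDomain S := IsIntegralClosure.isDedekindDomain R Q M S
  have hU : IsDedekindDomain U := IsIntegralClosure.isDedekindDomain R Q F U
  have hAK : IsFractionRing A K := IsIntegralClosure.isFractionRing_of_finite_extension R Q K A
  have hUF : IsFractionRing U F := IsIntegralClosure.isFractionRing_of_finite_extension R Q F U
  have : Module.Finite R A := IsIntegralClosure.finite R Q K A
  have : Module.Finite R U := IsIntegralClosure.finite R Q F U
  have : FaithfulSMul A U := (faithfulSMul_iff_algebraMap_injective _ _).2 fun x y hxy => by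
    apply IsFractionRing.injective A K
    apply (algebraMap K F).injective
    rw [← IsScalarTower.algebraMap_apply, ← IsScalarTower.algebraMap_apply,
      IsScalarTower.algebraMap_apply A U F, hxy, ← IsScalarTower.algebraMap_apply]
  have : Module.IsTorsionFree A U := inferInstance
  have : Module.IsTorsionFree S U := inferInstance
  have : FaithfulSMul R A := (faithfulSMul_iff_algebraMap_injective _ _).2 fun x y hxy => by
    apply IsFractionRing.injective R Q
    apply (algebraMap Q K).injective
    rw [← IsScalarTower.algebraMap_apply, ← IsScalarTower.algebraMap_apply,
      IsScalarTower.algebraMap_apply R A K, hxy, ← IsScalarTower.algebraMap_apply]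
  have : Module.IsTorsionFree R A := inferInstance
  have : Algebra.IsIntegral S U := Algebra.IsIntegral.tower_top R
  have : Algebra.IsIntegral A U := Algebra.IsIntegral.tower_top R
  obtain ⟨⟨W, hW, hWP⟩⟩ := (inferInstance : Nonempty (P.primesOver U))
  have hW0 : W ≠ ⊥ := Ideal.ne_bot_of_liesOver_of_ne_bot hP W
  let w : HeightOneSpectrum U := ⟨W, hW, hW0⟩
  let v : HeightOneSpectrum A := ⟨W.under A, inferInstance, mt Ideal.eq_bot_of_comap_eq_bot hW0⟩
  have hlies : w.asIdeal.LiesOver v.asIdeal := ⟨rfl⟩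
  have hWP' : w.asIdeal.LiesOver P := hWP
  have hdvdP := ramificationIdx_mul_inertiaDeg_dvd_card R Q M S P
  have hdvdv := ramificationIdx_mul_inertiaDeg_dvd_card R Q K A v.asIdeal
  refine ⟨hA, hU, hAK, hUF, inferInstance, v, w, hlies, ?_, fun h => ?_, fun h => ?_⟩
  · rw [Ideal.over_def W P]
    simp only [v, Ideal.under_under]
  · have h1 := Ideal.ramificationIdx_tower (R := R) v.asIdeal w.asIdeal
    have h2 := Ideal.ramificationIdx_below_dvd (R := R) P w.asIdeal
    rw [h1, h, mul_one] at h2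
    exact Nat.eq_one_of_dvd_coprimes hcop ((Dvd.intro _ rfl).trans hdvdP)
      (h2.trans ((Dvd.intro _ rfl).trans hdvdv))
  · have h1 := Ideal.inertiaDeg_tower (R := R) v.asIdeal w.asIdeal
    have h2 := Ideal.inertiaDeg_below_dvd (R := R) P w.asIdeal
    rw [h1, h, mul_one] at h2
    exact Nat.eq_one_of_dvd_coprimes hcop ((Dvd.intro_left _ rfl).trans hdvdP)
      (h2.trans ((Dvd.intro_left _ rfl).trans hdvdv))

end Tower

/-! ### Passing from a prime of `M` to a place of `F` -/

section Compositum

variable (R Q K M F S : Type*) [CommRing R] [IsDedekindDomain R]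
  [Field Q] [Algebra R Q] [IsFractionRing R Q]
  [Field K] [Algebra Q K] [FiniteDimensional Q K] [IsGalois Q K] [Algebra R K]
  [IsScalarTower R Q K]
  [Field M] [Algebra Q M] [FiniteDimensional Q M] [IsGalois Q M] [Algebra R M]
  [IsScalarTower R Q M]
  [Field F] [Algebra Q F] [Algebra K F] [FiniteDimensional K F] [Algebra.IsSeparable Q F] [Algebra R F]
  [IsScalarTower R Q F] [IsScalarTower Q K F] [Algebra M F] [IsScalarTower Q M F]
  [CommRing S] [IsDomain S] [Algebra R S] [Algebra S M] [IsScalarTower R S M]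
  [IsIntegralClosure S R M]

/-- The place is that of a prime of the integral closure of `R` in `F` above `P`. Its restriction to
`Q` is recorded so that the infinite place can be recognized later. -/
theorem exists_place_above (hcop : (Nat.card Gal(M/Q)).Coprime (Nat.card Gal(K/Q)))
    (P : Ideal S) [P.IsPrime] (hP : P ≠ ⊥) :
    ∃ B : ValuationSubring F, B ≠ ⊤ ∧
      (∃ p : HeightOneSpectrum R, (B.comap (algebraMap K F)).comap (algebraMap Q K) =
        (p.valuation Q).valuationSubring) ∧
      (IsUnramifiedPlace K B → P.ramificationIdx R = 1) ∧
      (Function.Surjective (placeResidueHom K B) → P.inertiaDeg R = 1) := by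
  have : FiniteDimensional Q F := FiniteDimensional.trans Q K F
  let A := integralClosure R K
  let U := integralClosure R F
  let : Algebra S F := ((algebraMap M F).comp (algebraMap S M)).toAlgebra
  have : IsScalarTower S M F := IsScalarTower.of_algebraMap_eq fun _ => rfl
  have : IsScalarTower R M F := IsScalarTower.to₁₃₄ R Q M F
  have : IsScalarTower R K F := IsScalarTower.to₁₃₄ R Q K F
  have : IsScalarTower R S F := IsScalarTower.to₁₂₄ R S M F
  have : IsScalarTower R A F := IsScalarTower.to₁₂₄ R A K F
  have : Algebra.IsIntegral R S := IsIntegralClosure.isIntegral_algebra R M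
  have : Algebra.IsIntegral R A := IsIntegralClosure.isIntegral_algebra R K
  let g : S →ₐ[R] U := IsIntegralClosure.lift R U F
  let h : A →ₐ[R] U := IsIntegralClosure.lift R U F
  let : Algebra S U := g.toAlgebra
  let : Algebra A U := h.toAlgebra
  have : IsScalarTower R S U := IsScalarTower.of_algebraMap_eq fun x => (g.commutes x).symm
  have : IsScalarTower R A U := IsScalarTower.of_algebraMap_eq fun x => (h.commutes x).symm
  have : IsScalarTower A U F := IsScalarTower.of_algebraMap_eq fun x =>
    (IsIntegralClosure.algebraMap_lift R U F x).symm
  have : FaithfulSMul S U := (faithfulSMul_iff_algebraMap_injective _ _).2 fun x y hxy => by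
    apply IsIntegralClosure.algebraMap_injective S R M
    apply (algebraMap M F).injective
    have := congrArg (algebraMap U F) hxy
    erw [IsIntegralClosure.algebraMap_lift, IsIntegralClosure.algebraMap_lift] at this
    exact this
  have : FaithfulSMul R S := (faithfulSMul_iff_algebraMap_injective _ _).2 fun x y hxy => by
    apply IsFractionRing.injective R Q
    apply (algebraMap Q M).injective
    rw [← IsScalarTower.algebraMap_apply, ← IsScalarTower.algebraMap_apply,
      IsScalarTower.algebraMap_apply R S M, hxy, ← IsScalarTower.algebraMap_apply]
  have : Module.IsTorsionFree R S := inferInstance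
  have : Algebra.IsIntegral R S := IsIntegralClosure.isIntegral_algebra R M
  obtain ⟨_, _, _, _, _, v, w, hwv, hv, hram, hin⟩ :=
    exists_heightOneSpectrum_above R Q K M F A S U hcop P hP
  have hp : P.under R ≠ ⊥ := mt Ideal.eq_bot_of_comap_eq_bot hP
  let p : HeightOneSpectrum R := ⟨P.under R, inferInstance, hp⟩
  have : v.asIdeal.LiesOver p.asIdeal := ⟨hv.symm⟩
  have : FaithfulSMul R A := (faithfulSMul_iff_algebraMap_injective _ _).2 fun x y hxy => by
    apply IsFractionRing.injective R Q
    apply (algebraMap Q K).injective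
    rw [← IsScalarTower.algebraMap_apply, ← IsScalarTower.algebraMap_apply,
      IsScalarTower.algebraMap_apply R A K, hxy, ← IsScalarTower.algebraMap_apply]
  have : Module.IsTorsionFree R A := inferInstance
  refine ⟨(w.valuation F).valuationSubring, ValuationSubring.valuation_ne_top_of_heightOneSpectrum w,
    ⟨p, ?_⟩, fun h => hram (ramificationIdx_eq_one_of_isUnramifiedPlace K F v w h),
    fun h => hin (inertiaDeg_eq_one_of_surjective_placeResidueHom K F v w h)⟩
  rw [comap_valuationSubring_liesOver v w, comap_valuationSubring_liesOver p v]

end Compositum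

theorem exists_sub_mem_of_inertiaDeg_eq_one {R S : Type*} [CommRing R] [CommRing S] [Algebra R S]
    (P : Ideal S) [P.IsMaximal] [(P.under R).IsMaximal] (h : P.inertiaDeg R = 1) (x : S) :
    ∃ r : R, x - algebraMap R S r ∈ P := by
  let := Ideal.Quotient.field (P.under R)
  rw [Ideal.inertiaDeg_eq_of_isMaximal (P.under R) P] at h
  have : Nontrivial (S ⧸ P) := Ideal.Quotient.nontrivial_iff.2 (Ideal.IsPrime.ne_top')
  obtain ⟨c, hc⟩ := (finrank_eq_one_iff_of_nonzero' (1 : S ⧸ P) one_ne_zero).1 h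
    (Ideal.Quotient.mk P x)
  obtain ⟨r, rfl⟩ := Ideal.Quotient.mk_surjective c
  refine ⟨r, Ideal.Quotient.eq.1 ?_⟩
  rw [← hc, Algebra.smul_def, mul_one]
  rfl

open Polynomial

/-! ### Descent of unramifiedness to `M/Q` -/

section UnramifiedAt

theorem ne_bot_of_isMaximal_of_isIntegralClosure (R Q M S : Type*) [CommRing R] [Field Q]
    [Algebra R Q] [IsFractionRing R Q] [Field M] [Algebra Q M] [Algebra R M] [IsScalarTower R Q M]
    [CommRing S] [IsDomain S] [Algebra R S] [Algebra S M] [IsScalarTower R S M]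
    [IsIntegralClosure S R M] (hR : ¬ IsField R) (P : Ideal S) (hP : P.IsMaximal) : P ≠ ⊥ := by
  have : Algebra.IsIntegral R S := IsIntegralClosure.isIntegral_algebra R M
  have hinj : Function.Injective (algebraMap R S) := fun x y hxy => by
    apply IsFractionRing.injective R Q
    apply (algebraMap Q M).injective
    rw [← IsScalarTower.algebraMap_apply, ← IsScalarTower.algebraMap_apply,
      IsScalarTower.algebraMap_apply R S M, hxy, ← IsScalarTower.algebraMap_apply]
  refine Ring.ne_bot_of_isMaximal_of_not_isField hP fun hS => hR ?_
  exact isField_of_isIntegral_of_isField hinj hS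

variable (R Q K M F S : Type*) [CommRing R] [IsDedekindDomain R]
  [Field Q] [Algebra R Q] [IsFractionRing R Q]
  [Field K] [Algebra Q K] [FiniteDimensional Q K] [IsGalois Q K]
  [Field M] [Algebra Q M] [FiniteDimensional Q M] [IsGalois Q M] [Algebra R M]
  [IsScalarTower R Q M]
  [Field F] [Algebra Q F] [Algebra K F] [FiniteDimensional K F] [Algebra.IsSeparable Q F]
  [IsScalarTower Q K F] [Algebra M F] [IsScalarTower Q M F]
  [CommRing S] [IsDomain S] [Algebra R S] [Algebra S M] [IsScalarTower R S M]
  [IsIntegralClosure S R M]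

theorem isUnramifiedAt_of_forall_isUnramifiedPlace (hR : ¬ IsField R)
    (hfin : ∀ p : Ideal R, p.IsMaximal → Finite (R ⧸ p))
    (hcop : (Nat.card Gal(M/Q)).Coprime (Nat.card Gal(K/Q)))
    (hunr : ∀ B : ValuationSubring F, B ≠ ⊤ → IsUnramifiedPlace K B)
    (P : Ideal S) (hP : P.IsMaximal) : Algebra.IsUnramifiedAt R P := by
  let : Algebra R K := ((algebraMap Q K).comp (algebraMap R Q)).toAlgebra
  let : Algebra R F := ((algebraMap Q F).comp (algebraMap R Q)).toAlgebra
  have : IsScalarTower R Q K := IsScalarTower.of_algebraMap_eq fun _ => rfl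
  have : IsScalarTower R Q F := IsScalarTower.of_algebraMap_eq fun _ => rfl
  have : Algebra.IsIntegral R S := IsIntegralClosure.isIntegral_algebra R M
  have hP0 : P ≠ ⊥ := ne_bot_of_isMaximal_of_isIntegralClosure R Q M S hR P hP
  obtain ⟨B, hB, -, h, -⟩ := exists_place_above R Q K M F S hcop P hP0
  have : Module.Finite R S := IsIntegralClosure.finite R Q M S
  have hmax : (P.under R).IsMaximal := Ideal.isMaximal_comap_of_isIntegral_of_isMaximal P
  have := hfin _ hmax
  -- A finite residue field is perfect, so ramification index one already gives unramifiedness.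
  have : Finite (P.under R).ResidueField :=
    Finite.of_surjective _ (P.under R).bijective_algebraMap_quotient_residueField.2
  exact (Ideal.ramificationIdx_eq_one_iff (R := R)).1 (h (hunr B hB))

end UnramifiedAt

/-! ### The rational case: Minkowski's theorem -/

section Rational

theorem Int.finite_quotient_of_isMaximal (p : Ideal ℤ) (hp : p.IsMaximal) : Finite (ℤ ⧸ p) :=
  Ring.HasFiniteQuotients.finiteQuotient
    (Ring.ne_bot_of_isMaximal_of_not_isField hp Int.not_isField)

theorem finrank_rat_eq_one_of_forall_isUnramifiedPlace (K M F : Type*)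
    [Field K] [Algebra ℚ K] [FiniteDimensional ℚ K] [IsGalois ℚ K]
    [Field M] [instM : Algebra ℚ M] [FiniteDimensional ℚ M] [IsGalois ℚ M]
    [Field F] [Algebra ℚ F] [Algebra K F] [FiniteDimensional K F] [IsScalarTower ℚ K F]
    [Algebra M F] [IsScalarTower ℚ M F]
    (hcop : (Nat.card Gal(M/ℚ)).Coprime (Nat.card Gal(K/ℚ)))
    (hunr : ∀ B : ValuationSubring F, B ≠ ⊤ → IsUnramifiedPlace K B) :
    Module.finrank ℚ M = 1 := by
  have : CharZero M := algebraRat.charZero M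
  -- Number fields carry the canonical `ℚ`-algebra structure; there is only one.
  obtain rfl : instM = DivisionRing.toRatAlgebra := Subsingleton.elim _ _
  have : NumberField M := { to_charZero := this, to_finiteDimensional := inferInstance }
  have : FiniteDimensional ℚ F := FiniteDimensional.trans ℚ K F
  by_contra h
  obtain ⟨P, hP, h'⟩ := NumberField.exists_not_isUnramifiedAt_int (K := M)
    (𝒪 := NumberField.RingOfIntegers M) h
  exact h' (isUnramifiedAt_of_forall_isUnramifiedPlace ℤ ℚ K M F _ Int.not_isField
    Int.finite_quotient_of_isMaximal hcop hunr P hP)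

end Rational

/-! ### The function field case -/

section FunctionField

variable (k : Type*) [Field k]

theorem Polynomial.finite_quotient_of_isMaximal [Finite k] (p : Ideal k[X]) (hp : p.IsMaximal) :
    Finite (k[X] ⧸ p) := by
  have hp0 : p ≠ ⊥ := Ring.ne_bot_of_isMaximal_of_not_isField hp (Polynomial.not_isField k)
  obtain ⟨f, rfl⟩ := (inferInstance : IsPrincipalIdealRing k[X]).principal p
  have hf : f ≠ 0 := by
    rintro rfl
    simp at hp0
  have : Module.Finite k (AdjoinRoot f) := (AdjoinRoot.powerBasis hf).finite
  exact Module.finite_of_finite k (M := AdjoinRoot f)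

/-- The valuation is nontrivial with values in `ℤ` and zero, so its range is not densely ordered. -/
theorem isPrincipalIdealRing_inftyValuation [DecidableEq (RatFunc k)] :
    IsPrincipalIdealRing (RatFunc.inftyValuation k).valuationSubring := by
  rw [(Valuation.valuationSubring.integers
    (RatFunc.inftyValuation k)).isPrincipalIdealRing_iff_not_denselyOrdered,
    WithZero.denselyOrdered_set_iff_subsingleton]
  simpa using (RatFunc.inftyValuation k).toMonoidWithZeroHom.range_nontrivial

theorem finite_quotient_inftyValuation [Finite k] [DecidableEq (RatFunc k)]
    (p : Ideal (RatFunc.inftyValuation k).valuationSubring) (hp : p.IsMaximal) :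
    Finite ((RatFunc.inftyValuation k).valuationSubring ⧸ p) := by
  let f : k → (RatFunc.inftyValuation k).valuationSubring ⧸ p := fun c =>
    Ideal.Quotient.mk p ⟨RatFunc.C c, RatFunc.inftyValuation_C_le_one c⟩
  refine Finite.of_surjective f fun x => ?_
  obtain ⟨r, rfl⟩ := Ideal.Quotient.mk_surjective x
  obtain ⟨c, hc⟩ := RatFunc.exists_inftyValuation_sub_C_lt_one r.2
  refine ⟨c, (Ideal.Quotient.eq.2 ?_).symm⟩
  rw [IsLocalRing.eq_maximalIdeal hp]
  exact (Valuation.mem_maximalIdeal_iff _ _).2 hc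

theorem not_isField_inftyValuation [DecidableEq (RatFunc k)] :
    ¬ IsField (RatFunc.inftyValuation k).valuationSubring := by
  intro h
  have hX : RatFunc.inftyValuation k (RatFunc.X)⁻¹ ≤ 1 := by
    rw [map_inv₀, RatFunc.inftyValuation.X, ← WithZero.exp_neg, ← WithZero.exp_zero,
      WithZero.exp_le_exp]
    omega
  obtain ⟨y, hy⟩ := h.mul_inv_cancel
    (a := (⟨(RatFunc.X)⁻¹, hX⟩ : (RatFunc.inftyValuation k).valuationSubring))
    fun h0 => inv_ne_zero RatFunc.X_ne_zero (congrArg Subtype.val h0)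
  have hy' : (RatFunc.X)⁻¹ * (y : RatFunc k) = 1 := congrArg Subtype.val hy
  have hyX : (y : RatFunc k) = RatFunc.X := by
    rw [eq_inv_of_mul_eq_one_right hy', inv_inv]
  have h1 : RatFunc.inftyValuation k y ≤ 1 := y.2
  rw [hyX, RatFunc.inftyValuation.X, ← WithZero.exp_zero, WithZero.exp_le_exp] at h1
  omega

/-- A local ring has only one maximal ideal, and the inverse of an element outside `B` lies in it.
This identifies the place below `B` in `F` with the infinite place. -/
theorem valuationSubring_eq_of_isLocalRing {Q : Type*} [Field Q] (B : ValuationSubring Q)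
    [IsDedekindDomain B] (p : HeightOneSpectrum B) : (p.valuation Q).valuationSubring = B := by
  apply le_antisymm
  · intro x hx
    by_contra hxB
    have hinv : x⁻¹ ∈ B := (B.mem_or_inv_mem x).resolve_left hxB
    have hmem : (⟨x⁻¹, hinv⟩ : B) ∈ p.asIdeal := by
      rw [IsLocalRing.eq_maximalIdeal p.isMaximal, IsLocalRing.mem_maximalIdeal, mem_nonunits_iff]
      intro hu
      obtain ⟨y, hy⟩ := hu.exists_left_inv
      have hy' : (y : Q) * x⁻¹ = 1 := congrArg Subtype.val hy
      have hx0 : x⁻¹ ≠ 0 := right_ne_zero_of_mul_eq_one hy'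
      have : (y : Q) = x := by
        rw [eq_inv_of_mul_eq_one_left hy', inv_inv]
      exact hxB (this ▸ y.2)
    have h1 : p.valuation Q (x⁻¹) < 1 := (p.valuation_lt_one_iff_mem (K := Q) _).2 hmem
    have hx' : p.valuation Q x ≤ 1 := hx
    have hx0 : x ≠ 0 := by
      rintro rfl
      exact hxB B.zero_mem
    rw [map_inv₀] at h1
    exact absurd ((one_le_inv₀ (zero_lt_iff.2 ((p.valuation Q).ne_zero_iff.2 hx0))).2 hx') (not_le.2 h1)
  · intro x hx
    exact p.valuation_le_one (K := Q) (⟨x, hx⟩ : B)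

theorem finrank_ratFunc_eq_one_of_forall_isUnramifiedPlace [Finite k] (K M F : Type*)
    [Field K] [Algebra (RatFunc k) K] [FiniteDimensional (RatFunc k) K] [IsGalois (RatFunc k) K]
    [Field M] [Algebra (RatFunc k) M] [FiniteDimensional (RatFunc k) M] [IsGalois (RatFunc k) M]
    [Field F] [Algebra (RatFunc k) F] [Algebra K F] [FiniteDimensional K F]
    [IsScalarTower (RatFunc k) K F] [Algebra.IsSeparable (RatFunc k) F]
    [Algebra M F] [IsScalarTower (RatFunc k) M F]
    (hcop : (Nat.card Gal(M/RatFunc k)).Coprime (Nat.card Gal(K/RatFunc k)))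
    (hunr : ∀ B : ValuationSubring F, B ≠ ⊤ → IsUnramifiedPlace K B)
    (hsplit : ∀ B : ValuationSubring F,
      (B.comap (algebraMap K F)).comap (algebraMap (RatFunc k) K) = ratFuncInftyPlace k →
        Function.Surjective (placeResidueHom K B)) :
    Module.finrank (RatFunc k) M = 1 := by
  classical
  let R := (RatFunc.inftyValuation k).valuationSubring
  have hR : ratFuncInftyPlace k = R := by
    unfold ratFuncInftyPlace
    congr!
  let : Algebra k[X] M := ((algebraMap (RatFunc k) M).comp (algebraMap k[X] (RatFunc k))).toAlgebra
  have : IsScalarTower k[X] (RatFunc k) M := IsScalarTower.of_algebraMap_eq fun _ => rfl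
  let : Algebra R M := ((algebraMap (RatFunc k) M).comp (algebraMap R (RatFunc k))).toAlgebra
  have : IsScalarTower R (RatFunc k) M := IsScalarTower.of_algebraMap_eq fun _ => rfl
  let : Algebra R K := ((algebraMap (RatFunc k) K).comp (algebraMap R (RatFunc k))).toAlgebra
  have : IsScalarTower R (RatFunc k) K := IsScalarTower.of_algebraMap_eq fun _ => rfl
  let : Algebra R F := ((algebraMap (RatFunc k) F).comp (algebraMap R (RatFunc k))).toAlgebra
  have : IsScalarTower R (RatFunc k) F := IsScalarTower.of_algebraMap_eq fun _ => rfl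
  have : IsPrincipalIdealRing R := isPrincipalIdealRing_inftyValuation k
  have hRf : ¬ IsField R := not_isField_inftyValuation k
  let S := integralClosure k[X] M
  let T := integralClosure R M
  have hS := isUnramifiedAt_of_forall_isUnramifiedPlace k[X] (RatFunc k) K M F S
    (Polynomial.not_isField k) (Polynomial.finite_quotient_of_isMaximal k) hcop hunr
  have hT := isUnramifiedAt_of_forall_isUnramifiedPlace R (RatFunc k) K M F T
    hRf (finite_quotient_inftyValuation k) hcop hunr
  -- Any maximal ideal of `T` lies above infinity, so the splitting hypothesis makes its inertia
  -- degree one.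
  obtain ⟨P, hP⟩ := Ideal.exists_maximal T
  obtain ⟨B, -, ⟨p, hp⟩, -, h⟩ := exists_place_above R (RatFunc k) K M F T hcop P
    (ne_bot_of_isMaximal_of_isIntegralClosure R (RatFunc k) M T hRf P hP)
  have hdeg := h (hsplit B (by rw [hp, hR]; exact valuationSubring_eq_of_isLocalRing R p))
  have : Algebra.IsIntegral R T := IsIntegralClosure.isIntegral_algebra R M
  have : (P.under R).IsMaximal := Ideal.isMaximal_comap_of_isIntegral_of_isMaximal P
  exact finrank_eq_one_of_isUnramifiedAt (Valuation.valuationSubring.integers _) hS hT P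
    (exists_sub_mem_of_inertiaDeg_eq_one P hdeg)

end FunctionField

/-! ### Assembling admissibility -/

section Admissible

variable {Q K L : Type*} [Field Q] [Field K] [Field L] [Algebra Q K] [Algebra Q L] [Algebra K L]
  [IsScalarTower Q K L] [Normal Q K] [IsGalois Q L] {Γ : Type*} [Group Γ]

/-- Since `Gal(L/Q)` is `Gal(L/K)` times the image of `s`, and that image acts trivially on `M`,
already `Gal(L/K)` surjects onto `Gal(M/Q)`. -/
theorem coprime_card_gal_of_fixed {ι : Gal(K/Q) ≃* Γ} {s : Γ →* Gal(L/Q)}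
    (hs : IsGaloisSection ι s) (hcop : IsProPrimeTo (Nat.card Γ) Gal(L/K))
    (M : IntermediateField Q L) [FiniteDimensional Q M] [IsGalois Q M]
    (hM : ∀ γ, ∀ x ∈ M, s γ x = x) : (Nat.card Gal(M/Q)).Coprime (Nat.card Gal(K/Q)) := by
  let φ : Gal(L/K) →* Gal(M/Q) :=
    (AlgEquiv.restrictNormalHom (F := Q) (K₁ := L) M).comp (AlgEquiv.restrictScalarsHom Q)
  have hsM : ∀ γ, AlgEquiv.restrictNormalHom (F := Q) (K₁ := L) M (s γ) = 1 := fun γ => by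
    rw [← MonoidHom.mem_ker, IntermediateField.restrictNormalHom_ker,
      IntermediateField.mem_fixingSubgroup_iff]
    exact hM γ
  have hφ : Function.Surjective φ := fun τ => by
    obtain ⟨e, rfl⟩ := AlgEquiv.restrictNormalHom_surjective (F := Q) (K₁ := M) L τ
    obtain ⟨g, γ, rfl⟩ := exists_eq_restrictScalars_mul hs e
    exact ⟨g, by rw [map_mul, hsM, mul_one]; rfl⟩
  have hopen : IsOpen (φ.ker : Set Gal(L/K)) := by
    have := (IntermediateField.fixingSubgroup_isOpen M).preimage
      (continuous_restrictScalarsHom (Q := Q) (K := K) (L := L))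
    rwa [← IntermediateField.restrictNormalHom_ker] at this
  have h := hcop { toSubgroup := φ.ker, isOpen' := hopen, isNormal' := inferInstance }
  change (φ.ker.index).Coprime _ at h
  rwa [Subgroup.index_ker, MonoidHom.range_eq_top.2 hφ, Subgroup.card_top,
    ← Nat.card_congr ι.toEquiv] at h

/-- By compactness `Gal(L/K)` embeds topologically in `Gal(L/Q)`, where the map is conjugation. -/
theorem continuous_conjGal (τ : Gal(L/Q)) : Continuous (conjGal (K := K) τ) := by
  have : IsGalois K L := IsGalois.tower_top_of_isGalois Q K L
  have hemb : Topology.IsEmbedding (AlgEquiv.restrictScalarsHom Q : Gal(L/K) →* Gal(L/Q)) :=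
    (continuous_restrictScalarsHom.isClosedEmbedding
      (AlgEquiv.restrictScalars_injective Q)).isEmbedding
  rw [hemb.continuous_iff]
  change Continuous fun σ : Gal(L/K) => τ * AlgEquiv.restrictScalarsHom Q σ * τ⁻¹
  exact (continuous_const.mul continuous_restrictScalarsHom).mul continuous_const

variable (L) in
theorem galoisGroupIsAdmissible_of_forall_finrank_eq_one [Finite Γ] [FiniteDimensional Q K]
    (ι : Gal(K/Q) ≃* Γ) (hcop : IsProPrimeTo (Nat.card Γ) Gal(L/K))
    (hM : ∀ (M : IntermediateField Q L) (F : IntermediateField K L), FiniteDimensional Q M →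
      IsGalois Q M → FiniteDimensional K F → M ≤ F.restrictScalars Q →
      (Nat.card Gal(M/Q)).Coprime (Nat.card Gal(K/Q)) → Module.finrank Q M = 1) :
    GaloisGroupIsAdmissible L ι := by
  have : IsGalois K L := IsGalois.tower_top_of_isGalois Q K L
  refine ⟨exists_isGaloisSection ι hcop, fun s hs => ?_⟩
  refine
    { isTopologicalGroup := inferInstance
      compactSpace := inferInstance
      t2Space := inferInstance
      totallyDisconnectedSpace := inferInstance
      continuous_act := fun γ => continuous_conjGal (s γ)
      proPrimeTo := hcop
      generated := fun H hH hstab hgen => ?_ }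
  refine eq_top_of_forall_fixed_eq_bot ι s hs (fun M _ _ hfix => ?_) H hH hstab hgen
  obtain ⟨S, hS⟩ : M.FG := IntermediateField.essFiniteType_iff.1 inferInstance
  rw [← IntermediateField.finrank_eq_one_iff]
  -- The compositum of `K` and `M`, generated over `K` by finitely many generators of `M`.
  refine hM M (IntermediateField.adjoin K (S : Set L)) inferInstance inferInstance ?_ ?_
    (coprime_card_gal_of_fixed hs hcop M hfix)
  · exact IntermediateField.finiteDimensional_adjoin fun x _ =>
      (Algebra.IsIntegral.isIntegral (R := Q) x).tower_top
  · rw [← hS, IntermediateField.adjoin_le_iff]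
    exact IntermediateField.subset_adjoin K _

/-- The inclusion of `M` into `F` for intermediate fields `M` of `L/Q` and `F` of `L/K`. -/
def IntermediateField.inclusionOfLeRestrictScalars (M : IntermediateField Q L)
    (F : IntermediateField K L) (h : M ≤ F.restrictScalars Q) : M →ₐ[Q] F :=
  IntermediateField.inclusion h

end Admissible

/-! ### The two base fields -/

theorem proposition2p2 {Γ : Type*} [Group Γ] [Finite Γ] :
    -- the case of the rational numbers
    (∀ (K : Type*) [Field K] [CharZero K] [IsGalois ℚ K] (ι : Gal(K/ℚ) ≃* Γ)
      (L : Type*) [Field L] [CharZero L] [Algebra K L] [IsGalois ℚ L],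
      IsUnramifiedExtension K L →
      IsProPrimeTo (Nat.card Γ) Gal(L/K) →
      GaloisGroupIsAdmissible L ι) ∧
    -- the case of a rational function field over a finite field
    (∀ (k : Type*) [Field k] [Finite k]
      (K : Type*) [Field K] [Algebra (RatFunc k) K] [IsGalois (RatFunc k) K]
      (ι : Gal(K/RatFunc k) ≃* Γ)
      (L : Type*) [Field L] [Algebra (RatFunc k) L] [Algebra K L]
      [IsScalarTower (RatFunc k) K L] [IsGalois (RatFunc k) L],
      IsUnramifiedExtension K L →
      (∀ A : ValuationSubring K, A.comap (algebraMap (RatFunc k) K) = ratFuncInftyPlace k →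
        SplitsCompletelyIn A L) →
      IsProPrimeTo (Nat.card Γ) Gal(L/K) →
      GaloisGroupIsAdmissible L ι) := by
  constructor
  · intro K _ _ _ ι L _ _ _ _ hunr hcop
    have : Finite Gal(K/ℚ) := Finite.of_equiv _ ι.symm.toEquiv
    have : FiniteDimensional ℚ K := IsGalois.finiteDimensional_of_finite ℚ K
    refine galoisGroupIsAdmissible_of_forall_finrank_eq_one L ι hcop fun M F _ _ _ hMF h => ?_
    -- Pins the `ℚ`-structures inherited from `L`, so that the inclusion of `M` in `F` is `ℚ`-linear
    -- for the instances in use.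
    let : Algebra ℚ M := IntermediateField.algebra' M
    let : Algebra ℚ F := IntermediateField.algebra' F
    let f := M.inclusionOfLeRestrictScalars F hMF
    let : Algebra M F := f.toAlgebra
    have : IsScalarTower ℚ M F := IsScalarTower.of_algebraMap_eq fun x => (f.commutes x).symm
    exact finrank_rat_eq_one_of_forall_isUnramifiedPlace K M F h (hunr F inferInstance)
  · intro k _ _ K _ _ _ ι L _ _ _ _ _ hunr hsplit hcop
    have : Finite Gal(K/RatFunc k) := Finite.of_equiv _ ι.symm.toEquiv
    have : FiniteDimensional (RatFunc k) K := IsGalois.finiteDimensional_of_finite (RatFunc k) K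
    refine galoisGroupIsAdmissible_of_forall_finrank_eq_one L ι hcop fun M F _ _ _ hMF h => ?_
    let f := M.inclusionOfLeRestrictScalars F hMF
    let : Algebra M F := f.toAlgebra
    have : IsScalarTower (RatFunc k) M F :=
      IsScalarTower.of_algebraMap_eq fun x => (f.commutes x).symm
    have : Algebra.IsSeparable (RatFunc k) F :=
      Algebra.IsSeparable.of_algHom (RatFunc k) L (F.val.restrictScalars (RatFunc k))
    -- The splitting hypothesis is applied to the place of `K` below `B`.
    exact finrank_ratFunc_eq_one_of_forall_isUnramifiedPlace k K M F h (hunr F inferInstance)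
      fun B hB => (hsplit _ hB F inferInstance B rfl).2
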